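/- Consider the bitruncated cubic honeycomb (the space-filling tessellation by truncated octahedra) with periodic boundary conditions in all three directions, on a torus of $L_1\times L_2\times L_3$ cubic unit cells, $L_1,L_2,L_3\ge 1$, each unit cell having two truncated octahedra, one for each of the two cubic sublattices of the body-centred cubic lattice of their centres. Let $V,E$ be the numbers of its vertices and edges, $n$ the number of its plaquettes (two-dimensional faces), and $\mathrm{vol}=L_1L_2L_3$. The square plaquettes are called $Y$-plaquettes; a hexagonal plaquette separates a cell of the first sublattice from one of the second, its normal pointing from the first to the second is proportional to $(\pm1,\pm1,\pm1)$, and it is called an $X$-plaquette if the product of these three signs is $+1$ and a $Z$-plaquette otherwise. (So every edge lies in one plaquette of each type.) Let $P_x,P_y,P_z$ be the sets of $X$-, $Y$-, $Z$-plaquettes and $n_x,n_y,n_z$ their sizes. Fix $\beta>0$ and $J>0$. The model has one qubit on each vertex and the Hamiltonian $H=-J\sum_{a\in\{x,y,z\}}\sum_{p\in P_a}\prod_{i\in p}\sigma^a_i$, the product being over the vertices $i$ of $p$. The Ising gauge theory on the same lattice has one spin on each edge and the Hamiltonian $H_{IG}=-J\sum_{p}\prod_{e\in\partial p}\sigma^z_e$,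 the sum being over all plaquettes $p$ and the product over the edges $e$ of $p$. Let $$Z(\beta J)=2^{-V}\,\mathrm{tr}\,e^{-\beta H},\qquad Z_{IG}(\beta J)=2^{-E}\,\mathrm{tr}\,e^{-\beta H_{IG}}$$ be their partition functions, computed with the trace normalized by $\mathrm{tr}\,1=1$. Let $\alpha=\tanh\beta J$. A closed surface is a set $c$ of plaquettes such that every edge lies in an even number of plaquettes of $c$; let $A_c$ be its number of plaquettes and $n_i^c$ its number of plaquettes in $P_i$. The cross terms and the global-product terms are $$C.T.=\sum_{c\neq\emptyset}\alpha^{A_c}\sum_{i\in\{x,y,z\}}\alpha^{n_i-2n_i^c},\qquad G.T.=(1+\alpha^{n_x})(1+\alpha^{n_y})(1+\alpha^{n_z})-1,$$ the first sum being over the non-empty closed surfaces. Then: 1. $\displaystyle\lim_{\mathrm{vol}\to\infty}\frac{Z(\beta J)}{Z_{IG}(\beta J)}=1$, for every way in which $L_1L_2L_3\to\infty$. 2. There are $C$ and $0<\lambda<1$, depending only on $\beta$ and $J$, such that for all $L_1,L_2,L_3$ $$\left|\frac{Z(\beta J)}{Z_{IG}(\beta J)}-1\right|\le C\lambda^n .$$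 3. There are $C$ and $0<\lambda<1$, depending only on $\beta$ and $J$, such that for all $L_1,L_2,L_3$ $$(\cosh\beta J)^n\,(C.T.+G.T.)\le C\lambda^n\,Z_{IG}(\beta J).$$ 4. There are $0<\epsilon<1$, a renormalized coupling $J'>J$ with $\tanh\beta J'=(\tanh\beta J)^{\epsilon}$, and $C$ and $0<\lambda<1$, all depending only on $\beta$ and $J$, such that for all $L_1,L_2,L_3$ $$(\cosh\beta J)^n\,(C.T.+G.T.)\le C\lambda^n\,Z_{IG}(\beta J').$$ -/

import Mathlib

open Filter Topology

noncomputable section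

namespace PlaquetteModel

/-! ### Qubit systems -/

/-- Operators on a register of qubits labelled by `S`, as matrices in the computational basis
`S → Fin 2`. -/
abbrev Op (S : Type) : Type := Matrix (S → Fin 2) (S → Fin 2) ℂ

/-- The tensor product `⨂ s, A s` of one-qubit operators. -/
def tensorOp {S : Type} [Fintype S] (A : S → Matrix (Fin 2) (Fin 2) ℂ) : Op S :=
  Matrix.of fun σ τ => ∏ s, A s (σ s) (τ s)

/-- The three Pauli labels. -/
inductive Axis : Type
  | x
  | y
  | z
  deriving DecidableEq

instance : Fintype Axis where
  elems := {Axis.x, Axis.y, Axis.z}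
  complete a := by cases a <;> simp

/-- The Pauli matrices. -/
def pauli : Axis → Matrix (Fin 2) (Fin 2) ℂ
  | Axis.x => !![0, 1; 1, 0]
  | Axis.y => !![0, -Complex.I; Complex.I, 0]
  | Axis.z => !![1, 0; 0, -1]

open scoped Classical in
/-- The operator `∏_{s ∈ T} σ_s^a`: the Pauli matrix of type `a` on every qubit of `T`, and the
identity on all other qubits. -/
def pauliOn {S : Type} [Fintype S] (a : Axis) (T : Set S) : Op S :=
  tensorOp fun s => if s ∈ T then pauli a else 1

open scoped Classical in
/-- The partition function `tr (exp (-β H))`. -/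
def partitionFunction {S : Type} [Fintype S] (β : ℝ) (H : Op S) : ℂ :=
  Matrix.trace (NormedSpace.exp (-(β : ℂ) • H))

/-- The partition function computed with the normalized trace `tr (1) = 1`, that is,
`tr (exp (-β H)) / 2 ^ |S|`. -/
def normalizedPartitionFunction {S : Type} [Fintype S] (β : ℝ) (H : Op S) : ℂ :=
  partitionFunction β H / 2 ^ Fintype.card S

/-! ### The bitruncated cubic honeycomb on a three-dimensional torus

Coordinates are chosen such that the truncated octahedra are centred at the points of
`(4ℤ)³ ∪ ((4ℤ)³ + (2,2,2))`, the one centred at the origin having as vertices the `24` points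
obtained from `(0, ±1, ±2)` by permuting coordinates.  Everything is periodic with period
`4 L i` in direction `i`. -/

/-- The discrete torus `∏ i, ℤ / (4 L i)`. -/
abbrev Torus (L : Fin 3 → ℕ+) : Type := ∀ i : Fin 3, ZMod (4 * (L i : ℕ))

instance (n : ℕ+) : NeZero (4 * (n : ℕ)) := ⟨by positivity⟩

/-- The `i`-th coordinate modulo `4`. -/
def res {L : Fin 3 → ℕ+} (q : Torus L) (i : Fin 3) : ZMod 4 :=
  ZMod.castHom (Dvd.intro (L i : ℕ) rfl) (ZMod 4) (q i)

/-- `q` is a vertex of the honeycomb: modulo `4`, its coordinates are `0`, `2` and an odd number,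
in some order. -/
def IsVertex {L : Fin 3 → ℕ+} (q : Torus L) : Prop :=
  ∃ π : Equiv.Perm (Fin 3), res q (π 0) = 0 ∧ res q (π 1) = 2 ∧
    (res q (π 2) = 1 ∨ res q (π 2) = 3)

/-- `q` is the centre of a hexagonal plaquette (separating a cell of each of the two cubic
sublattices): all its coordinates are odd. -/
def IsHexagonCentre {L : Fin 3 → ℕ+} (q : Torus L) : Prop :=
  ∀ i, res q i = 1 ∨ res q i = 3

/-- `q` is the centre of a square plaquette (separating two cells of the same sublattice): modulo
`4`, its coordinates are `0` and `2`, not all equal. -/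
def IsSquareCentre {L : Fin 3 → ℕ+} (q : Torus L) : Prop :=
  (∀ i, res q i = 0 ∨ res q i = 2) ∧ ∃ i j, res q i ≠ res q j

/-- The type of a plaquette, by its centre.  The squares are the `Y`-plaquettes.  The normal of
a hexagon that points away from the cell centred in `(4ℤ)³` is `(±1, ±1, ±1)`, where the `i`-th sign
is `+` if the `i`-th coordinate of the centre is `1` modulo `4` and `-` if it is `3`; the hexagon is
an `X`-plaquette if the product of the signs is `+` and a `Z`-plaquette otherwise.  Hence four of
the eight hexagons of every cell are `X`-plaquettes, four are `Z`-plaquettes, and every edge lies in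
one plaquette of each type. -/
def IsCentre {L : Fin 3 → ℕ+} : Axis → Torus L → Prop
  | Axis.x, q => IsHexagonCentre q ∧ Even (Set.ncard {i | res q i = 3})
  | Axis.y, q => IsSquareCentre q
  | Axis.z, q => IsHexagonCentre q ∧ Odd (Set.ncard {i | res q i = 3})

/-- `d` is one of the six vectors `± e_i`. -/
def IsAxialStep {L : Fin 3 → ℕ+} (d : Torus L) : Prop :=
  ∃ (i : Fin 3) (s : ℤˣ), d = Pi.single i (((s : ℤ) : ZMod (4 * (L i : ℕ))))

/-- `d` is one of the twelve vectors `± e_i ± e_j` with `i ≠ j`. -/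
def IsDiagonalStep {L : Fin 3 → ℕ+} (d : Torus L) : Prop :=
  ∃ (i j : Fin 3) (s t : ℤˣ), i ≠ j ∧
    d = Pi.single i (((s : ℤ) : ZMod (4 * (L i : ℕ)))) +
      Pi.single j (((t : ℤ) : ZMod (4 * (L j : ℕ))))

/-- The vertices of the lattice, on which the qubits of the model live. -/
abbrev Vertex (L : Fin 3 → ℕ+) : Type := {q : Torus L // IsVertex q}

instance (L : Fin 3 → ℕ+) : Fintype (Vertex L) := Fintype.ofFinite _

/-- The graph of vertices and edges: two vertices are joined if they differ by a vector
`± e_i ± e_j`, which is the edge length of the honeycomb. -/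
def edgeGraph (L : Fin 3 → ℕ+) : SimpleGraph (Vertex L) :=
  SimpleGraph.fromRel fun v w => IsDiagonalStep (v.1 - w.1)

/-- The edges of the lattice, on which the spins of the Ising gauge theory live. -/
abbrev Edge (L : Fin 3 → ℕ+) : Type := {e : Sym2 (Vertex L) // e ∈ (edgeGraph L).edgeSet}

instance (L : Fin 3 → ℕ+) : Fintype (Edge L) := Fintype.ofFinite _

/-- The plaquettes of type `a`. -/
abbrev PlaquetteOf (L : Fin 3 → ℕ+) (a : Axis) : Type := {q : Torus L // IsCentre a q}

instance (L : Fin 3 → ℕ+) (a : Axis) : Fintype (PlaquetteOf L a) := Fintype.ofFinite _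

/-- All plaquettes. -/
abbrev Plaquette (L : Fin 3 → ℕ+) : Type := Σ a : Axis, PlaquetteOf L a

/-- The vertices of a plaquette: four for a square, six for a hexagon. -/
def plaquetteVertices {L : Fin 3 → ℕ+} : Plaquette L → Set (Vertex L)
  | ⟨Axis.x, q⟩ => {v | IsDiagonalStep (v.1 - q.1)}
  | ⟨Axis.y, q⟩ => {v | IsAxialStep (v.1 - q.1)}
  | ⟨Axis.z, q⟩ => {v | IsDiagonalStep (v.1 - q.1)}

/-- The edges of a plaquette: the edges with both endpoints on it. -/
def plaquetteEdges {L : Fin 3 → ℕ+} (p : Plaquette L) : Set (Edge L) :=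
  {e | ∀ v ∈ e.1, v ∈ plaquetteVertices p}

/-- The volume of the lattice: its number of cubic unit cells. -/
def vol (L : Fin 3 → ℕ+) : ℕ := ∏ i, (L i : ℕ)

/-- The number of plaquettes of type `a`. -/
def numOf (L : Fin 3 → ℕ+) (a : Axis) : ℕ := Fintype.card (PlaquetteOf L a)

/-- The total number of plaquettes. -/
def numPlaquettes (L : Fin 3 → ℕ+) : ℕ := Fintype.card (Plaquette L)

/-! ### The two models -/

/-- The Hamiltonian `H = -J (∑ B_p^x + ∑ B_p^y + ∑ B_p^z)` of the model, where `B_p^a` is the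
product of the Pauli operators of type `a` over the vertices of the plaquette `p` of type `a`. -/
def modelHamiltonian (J : ℝ) (L : Fin 3 → ℕ+) : Op (Vertex L) :=
  -(J : ℂ) • ∑ a : Axis, ∑ q : PlaquetteOf L a, pauliOn a (plaquetteVertices ⟨a, q⟩)

/-- The Hamiltonian of the Ising gauge theory on the same lattice: `-J ∑_p ∏_{e ∈ p} Z_e`. -/
def gaugeHamiltonian (J : ℝ) (L : Fin 3 → ℕ+) : Op (Edge L) :=
  -(J : ℂ) • ∑ p : Plaquette L, pauliOn Axis.z (plaquetteEdges p)

/-- `Z(βJ)`, with the normalized trace. -/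
def modelZ (β J : ℝ) (L : Fin 3 → ℕ+) : ℂ :=
  normalizedPartitionFunction β (modelHamiltonian J L)

/-- `Z_IG(βJ)`, with the normalized trace. -/
def gaugeZ (β J : ℝ) (L : Fin 3 → ℕ+) : ℂ :=
  normalizedPartitionFunction β (gaugeHamiltonian J L)

/-! ### Cross terms and global-product terms -/

open scoped Classical in
/-- The closed surfaces: the sets of plaquettes that contain an even number of the
plaquettes at every edge. -/
def closedSurfaces (L : Fin 3 → ℕ+) : Finset (Finset (Plaquette L)) :=
  Finset.univ.filter fun c =>
    ∀ e : Edge L, Even (c.filter fun p => e ∈ plaquetteEdges p).card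

/-- `n_a^c`, the number of plaquettes of type `a` in `c`. -/
def numIn {L : Fin 3 → ℕ+} (a : Axis) (c : Finset (Plaquette L)) : ℕ :=
  (c.filter fun p => p.1 = a).card

/-- The cross terms `∑_{c ≠ ∅} α ^ A_c ∑_a α ^ (n_a - 2 n_a^c)`, where `c` runs over the
non-empty closed surfaces. -/
def crossTerms (α : ℝ) (L : Fin 3 → ℕ+) : ℝ :=
  ∑ c ∈ (closedSurfaces L).filter fun c => c.Nonempty,
    α ^ c.card * ∑ a : Axis, α ^ ((numOf L a : ℤ) - 2 * (numIn a c : ℤ))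

/-- The global-product terms `(1 + α ^ n_x) (1 + α ^ n_y) (1 + α ^ n_z) - 1`. -/
def globalTerms (α : ℝ) (L : Fin 3 → ℕ+) : ℝ :=
  ∏ a : Axis, (1 + α ^ numOf L a) - 1

end PlaquetteModel

end

/-! Both partition functions have a high-temperature expansion over sets `c` of plaquettes, with
weight `α ^ |c|`, `α = tanh βJ`, and a common factor `cosh ^ n`. In the gauge theory only the sets
that are even at every edge survive the trace (`gaugeZ_eq`), giving `evenSum`. In the model every
`c` carries the normalized trace of its product of Pauli operators, which factorizes over the
vertices (`modelZ_eq`).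

At a vertex this trace vanishes unless the numbers of X-, Y- and Z-plaquettes of `c` there are all
even or all odd. Two plaquettes of each type meet at the vertex, and its four edges correspond to
the sign pairs `(t, u)`, lying in the plaquettes with indices `t`, `u` and `t * u`. Hence a nonzero
trace forces equal parity at the four edges, and since the lattice is connected, `c` is even at all
edges or odd at all edges (`even_or_odd_of_prod_ne_zero`). For the even sets, the closed surfaces,
the trace is exactly `1` (`prod_localTrace_of_even`); this sign computation amounts to the number of
hexagons being even. So the model differs from the gauge theory by at most `oddSum`
(`norm_sum_sub_evenSum_le`).

The main estimate is that `oddSum / evenSum` is the gauge-theory expectation of the product of all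
edge spins. Mark one edge per unit cell so that no plaquette contains two of them. With all other
spins fixed, the marked spins are independent, and each has mean at most `contraction α 3 < 1` in
absolute value, because an edge meets at most three plaquettes. Therefore `oddSum ≤ contraction α 3
^ vol * evenSum` (`oddSum_le`, `oddSum_edgeInc_le`), and `n ≤ 192 vol` turns this into a rate per
plaquette.

The cross terms obey the same bound: symmetric difference with all plaquettes of one type injects
closed surfaces into odd sets, and the exponent in the cross terms is the size of the image
(`crossTerms_le`). The global terms are at most `7 α ^ vol`. The comparison at `J'` follows from the
one at `J`, as `Z_IG` increases with the coupling. -/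

set_option linter.unusedSimpArgs false

noncomputable section

namespace PlaquetteModel

/-! ### Sums over even and odd configurations of an abstract gauge theory -/

section Abstract

open scoped Classical

variable {E P ι : Type*}

/-- The number of elements of `c` incident to `e`. -/
def incCount (inc : P → E → Prop) (c : Finset P) (e : E) : ℕ :=
  (c.filter fun p => inc p e).card

/-- The sum of `α ^ |c|` over the configurations that are even at every `e`. -/
def evenSum [Fintype P] (inc : P → E → Prop) (α : ℝ) : ℝ :=
  ∑ c ∈ (Finset.univ : Finset (Finset P)).filter (fun c => ∀ e, Even (incCount inc c e)),
    α ^ c.card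

/-- The sum of `α ^ |c|` over the configurations that are odd at every `e`. -/
def oddSum [Fintype P] (inc : P → E → Prop) (α : ℝ) : ℝ :=
  ∑ c ∈ (Finset.univ : Finset (Finset P)).filter (fun c => ∀ e, Odd (incCount inc c e)),
    α ^ c.card

/-- The flux of a spin configuration through `p`. -/
def flux [Fintype E] (inc : P → E → Prop) (p : P) (σ : E → ℤˣ) : ℤˣ :=
  ∏ e, if inc p e then σ e else 1

lemma flux_mul [Fintype E] (inc : P → E → Prop) (p : P) (σ τ : E → ℤˣ) :
    flux inc p (σ * τ) = flux inc p σ * flux inc p τ := by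
  simp only [flux, ← Finset.prod_mul_distrib]
  refine Finset.prod_congr rfl fun e _ => ?_
  split_ifs <;> simp

/-- The weight of a spin configuration. -/
def spinWeight [Fintype E] [Fintype P] (inc : P → E → Prop) (α : ℝ) (σ : E → ℤˣ) : ℝ :=
  ∏ p, (1 + α * ((flux inc p σ : ℤ) : ℝ))

lemma prod_flux [Fintype E] (inc : P → E → Prop) (c : Finset P) (σ : E → ℤˣ) :
    ∏ p ∈ c, flux inc p σ = ∏ e, σ e ^ incCount inc c e := by
  simp only [flux, incCount]
  rw [Finset.prod_comm]
  refine Finset.prod_congr rfl fun e _ => ?_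
  rw [Finset.prod_ite, Finset.prod_const, Finset.prod_const_one, mul_one]

/-- High-temperature expansion: in the term that selects the plaquettes of `c`, the spin at `e`
occurs once for each element of `c` incident to `e`. -/
lemma spinWeight_eq_sum [Fintype E] [Fintype P] (inc : P → E → Prop) (α : ℝ) (σ : E → ℤˣ) :
    spinWeight inc α σ =
      ∑ c : Finset P, α ^ c.card * ∏ e, (((σ e : ℤˣ) : ℤ) : ℝ) ^ incCount inc c e := by
  rw [spinWeight, Finset.prod_one_add, Finset.powerset_univ]
  refine Finset.sum_congr rfl fun c _ => ?_
  rw [Finset.prod_mul_distrib, Finset.prod_const]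
  congr 1
  have := congrArg (fun u : ℤˣ => ((u : ℤ) : ℝ)) (prod_flux inc c σ)
  simpa using this

/-- The sum factorizes over `e`, and an odd power of a spin sums to zero. -/
lemma sum_prod_units_pow [Fintype E] (k : E → ℕ) :
    ∑ σ : E → ℤˣ, ∏ e, (((σ e : ℤˣ) : ℤ) : ℝ) ^ k e =
      if ∀ e, Even (k e) then (2 : ℝ) ^ Fintype.card E else 0 := by
  have h := (Finset.prod_univ_sum (fun _ : E => (Finset.univ : Finset ℤˣ))
    (fun e u => ((u : ℤ) : ℝ) ^ k e)).symm
  rw [Fintype.piFinset_univ] at h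
  rw [h]
  have h2 : ∀ e, ∑ u : ℤˣ, ((u : ℤ) : ℝ) ^ k e = if Even (k e) then (2 : ℝ) else 0 := by
    intro e
    rw [show (Finset.univ : Finset ℤˣ) = {1, -1} from rfl, Finset.sum_pair (by decide)]
    split_ifs with he
    · simp [he.neg_one_pow]; norm_num
    · simp [(Nat.not_even_iff_odd.1 he).neg_one_pow]
  simp only [h2]
  split_ifs with ha
  · simp [ha]
  · obtain ⟨e, he⟩ := not_forall.1 ha
    exact Finset.prod_eq_zero (Finset.mem_univ e) (by simp [he])

lemma sum_spinWeight [Fintype E] [Fintype P] (inc : P → E → Prop) (α : ℝ) :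
    ∑ σ, spinWeight inc α σ = 2 ^ Fintype.card E * evenSum inc α := by
  simp only [spinWeight_eq_sum]
  rw [Finset.sum_comm]
  simp only [← Finset.mul_sum, sum_prod_units_pow]
  rw [evenSum, Finset.sum_filter, Finset.mul_sum]
  refine Finset.sum_congr rfl fun c _ => ?_
  split_ifs <;> ring

/-- Inserting every spin once raises all exponents by one, which exchanges even and odd. Together
with `sum_spinWeight` this makes `oddSum / evenSum` the expectation of the product of all spins. -/
lemma sum_prod_mul_spinWeight [Fintype E] [Fintype P] (inc : P → E → Prop) (α : ℝ) :
    ∑ σ : E → ℤˣ, (∏ e, (((σ e : ℤˣ) : ℤ) : ℝ)) * spinWeight inc α σ =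
      2 ^ Fintype.card E * oddSum inc α := by
  simp only [spinWeight_eq_sum, Finset.mul_sum]
  rw [Finset.sum_comm]
  have : ∀ (c : Finset P) (σ : E → ℤˣ), (∏ e, (((σ e : ℤˣ) : ℤ) : ℝ)) *
      (α ^ c.card * ∏ e, (((σ e : ℤˣ) : ℤ) : ℝ) ^ incCount inc c e) =
      α ^ c.card * ∏ e, (((σ e : ℤˣ) : ℤ) : ℝ) ^ (incCount inc c e + 1) := by
    intro c σ
    simp only [pow_succ, Finset.prod_mul_distrib]
    ring
  simp only [this, ← Finset.mul_sum, sum_prod_units_pow]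
  rw [oddSum, Finset.sum_filter, Finset.mul_sum]
  refine Finset.sum_congr rfl fun c _ => ?_
  simp only [Nat.even_add_one, Nat.not_even_iff_odd]
  split_ifs <;> ring

/-- The contraction factor of a spin that belongs to at most `K` plaquettes. -/
def contraction (α : ℝ) (K : ℕ) : ℝ :=
  ((1 + α) ^ K - (1 - α) ^ K) / ((1 + α) ^ K + (1 - α) ^ K)

lemma contraction_pos {α : ℝ} (h0 : 0 < α) (h1 : α < 1) {K : ℕ} (hK : K ≠ 0) :
    0 < contraction α K := by
  have h2 : (1 - α) ^ K < (1 + α) ^ K := pow_lt_pow_left₀ (by linarith) (by linarith) hK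
  have h3 : 0 < (1 - α) ^ K := pow_pos (by linarith) _
  exact div_pos (by linarith) (by linarith)

lemma contraction_lt_one {α : ℝ} (h0 : 0 < α) (h1 : α < 1) (K : ℕ) :
    contraction α K < 1 := by
  have h3 : 0 < (1 - α) ^ K := pow_pos (by linarith) _
  have h2 : 0 < (1 + α) ^ K := pow_pos (by linarith) _
  rw [contraction, div_lt_one (by linarith)]
  linarith

/-- The quotient `|a - b| / (a + b)` depends only on `a / b` and is largest when `a` and `b` are the
opposite endpoints of the interval. -/
lemma abs_sub_le_contraction {α : ℝ} (h0 : 0 < α) (h1 : α < 1) {K : ℕ} {a b : ℝ}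
    (ha : (1 - α) ^ K ≤ a) (ha' : a ≤ (1 + α) ^ K) (hb : (1 - α) ^ K ≤ b)
    (hb' : b ≤ (1 + α) ^ K) : |a - b| ≤ contraction α K * (a + b) := by
  have h3 : 0 < (1 - α) ^ K := pow_pos (by linarith) _
  have h2 : 0 < (1 + α) ^ K := pow_pos (by linarith) _
  rw [contraction, div_mul_eq_mul_div, le_div_iff₀ (by linarith)]
  set x := (1 + α) ^ K
  set y := (1 - α) ^ K
  rcases abs_cases (a - b) with ⟨h, _⟩ | ⟨h, _⟩ <;> rw [h]
  · have : a * y ≤ x * b := mul_le_mul ha' hb h3.le h2.le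
    linarith
  · have : b * y ≤ x * a := mul_le_mul hb' ha h3.le h2.le
    linarith

lemma prod_one_add_mem {α : ℝ} (h0 : 0 < α) (h1 : α < 1) {K : ℕ} (s : Finset P)
    (hs : s.card ≤ K) (u : P → ℤˣ) :
    (1 - α) ^ K ≤ ∏ p ∈ s, (1 + α * ((u p : ℤ) : ℝ)) ∧
      ∏ p ∈ s, (1 + α * ((u p : ℤ) : ℝ)) ≤ (1 + α) ^ K := by
  have hu : ∀ p, 1 - α ≤ 1 + α * ((u p : ℤ) : ℝ) ∧ 1 + α * ((u p : ℤ) : ℝ) ≤ 1 + α := by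
    intro p
    rcases Int.units_eq_one_or (u p) with h | h <;> rw [h] <;> constructor <;> norm_num <;> linarith
  constructor
  · calc (1 - α) ^ K ≤ (1 - α) ^ s.card :=
          pow_le_pow_of_le_one (by linarith) (by linarith) hs
      _ = ∏ _p ∈ s, (1 - α) := by rw [Finset.prod_const]
      _ ≤ _ := Finset.prod_le_prod (fun _ _ => by linarith) fun p _ => (hu p).1
  · calc _ ≤ ∏ _p ∈ s, (1 + α) :=
          Finset.prod_le_prod (fun p _ => by linarith [(hu p).1]) fun p _ => (hu p).2
      _ = (1 + α) ^ s.card := by rw [Finset.prod_const]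
      _ ≤ _ := pow_le_pow_right₀ (by linarith) hs

/-- The spin configuration that equals `τ i` at `g i` and `1` elsewhere. -/
def extendSpin (g : ι → E) (τ : ι → ℤˣ) : E → ℤˣ := Function.extend g τ 1

lemma prod_extendSpin [Fintype E] [Fintype ι] {g : ι → E} (hg : Function.Injective g) (τ : ι → ℤˣ) :
    ∏ e, extendSpin g τ e = ∏ i, τ i := by
  rw [← Finset.prod_subset (Finset.subset_univ (Finset.univ.image g))]
  · rw [Finset.prod_image fun a _ b _ h => hg h]
    exact Finset.prod_congr rfl fun i _ => hg.extend_apply τ 1 i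
  · intro e _ he
    exact Function.extend_apply' _ _ _ fun ⟨i, hi⟩ => he (by simp [← hi])

/-- Each `p` meets at most one of the `g i`, namely the one recorded by `own p`, so at most one
factor of the flux differs from `1`. -/
lemma flux_extendSpin [Fintype E] [Fintype ι] {inc : P → E → Prop} {g : ι → E} (hg : Function.Injective g)
    {own : P → Option ι} (hown : ∀ p i, inc p (g i) ↔ own p = some i) (p : P) (τ : ι → ℤˣ) :
    flux inc p (extendSpin g τ) = (own p).elim 1 τ := by
  have h1 : flux inc p (extendSpin g τ) = ∏ i, if inc p (g i) then τ i else 1 := by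
    rw [flux, ← Finset.prod_subset (Finset.subset_univ (Finset.univ.image g))]
    · rw [Finset.prod_image fun a _ b _ h => hg h]
      exact Finset.prod_congr rfl fun i _ => by rw [extendSpin, hg.extend_apply]
    · intro e _ he
      rw [extendSpin, Function.extend_apply' _ _ _ fun ⟨i, hi⟩ => he (by simp [← hi])]
      simp
  rw [h1]
  simp only [hown]
  cases h : own p with
  | none => simp
  | some j => simp

/-- If no plaquette contains two of the edges `g i` and each `g i` is in at most `K` plaquettes,
the odd sum is at most the even sum times the contraction factor of each of these edges. -/
theorem oddSum_le [Fintype E] [Fintype P] [Fintype ι] (inc : P → E → Prop) {α : ℝ} (h0 : 0 < α) (h1 : α < 1) {g : ι → E}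
    (hg : Function.Injective g) {own : P → Option ι}
    (hown : ∀ p i, inc p (g i) ↔ own p = some i) {K : ℕ}
    (hK : ∀ i, (Finset.univ.filter fun p => own p = some i).card ≤ K) :
    oddSum inc α ≤ contraction α K ^ Fintype.card ι * evenSum inc α := by
  set W := spinWeight inc α
  set F : (E → ℤˣ) → Option ι → ℤˣ → ℝ := fun σ o u =>
    ∏ p ∈ Finset.univ.filter (fun p => own p = o), (1 + α * (((flux inc p σ * u : ℤˣ) : ℤ) : ℝ))
  set ε : (E → ℤˣ) → ℝ := fun σ => ∏ e, (((σ e : ℤˣ) : ℤ) : ℝ)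
  -- Grouping the plaquettes by `own` decouples the marked spins: `τ i` enters only the factors of
  -- the plaquettes owned by `i`.
  have hW : ∀ σ τ, W (σ * extendSpin g τ) = F σ none 1 * ∏ i, F σ (some i) (τ i) := by
    intro σ τ
    have h := Fintype.prod_option (fun o => F σ o (o.elim 1 τ))
    simp only [Option.elim] at h
    rw [← h]
    simp only [W, F, spinWeight]
    rw [← Finset.prod_fiberwise Finset.univ own]
    refine Finset.prod_congr rfl fun o _ => Finset.prod_congr rfl fun p hp => ?_
    rw [flux_mul, flux_extendSpin hg hown, (Finset.mem_filter.1 hp).2]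
    rfl
  have hε : ∀ σ τ, ε (σ * extendSpin g τ) = ε σ * ∏ i, (((τ i : ℤˣ) : ℤ) : ℝ) := by
    intro σ τ
    have := congrArg (fun u : ℤˣ => ((u : ℤ) : ℝ)) (prod_extendSpin hg τ)
    simp only [ε, Pi.mul_apply, Units.val_mul, Int.cast_mul, Finset.prod_mul_distrib]
    congr 1
    simpa using this
  -- Flipping marked spins permutes the configurations, so summing over all flips as well only
  -- multiplies a sum by a constant. This replaces conditioning on the unmarked spins.
  have hshift : ∀ G : (E → ℤˣ) → ℝ, ∑ σ, ∑ τ : ι → ℤˣ, G (σ * extendSpin g τ) =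
      Fintype.card (ι → ℤˣ) * ∑ σ, G σ := by
    intro G
    rw [Finset.sum_comm]
    have : ∀ τ : ι → ℤˣ, ∑ σ, G (σ * extendSpin g τ) = ∑ σ, G σ := fun τ =>
      Fintype.sum_equiv (Equiv.mulRight (extendSpin g τ)) _ _ fun _ => rfl
    simp [this]
  have hF : ∀ σ o u, 0 < F σ o u := by
    intro σ o u
    refine Finset.prod_pos fun p _ => ?_
    rcases Int.units_eq_one_or (flux inc p σ * u) with h | h <;> rw [h] <;> norm_num <;> linarith
  have hsum : ∀ f : ι → ℤˣ → ℝ, ∑ τ : ι → ℤˣ, ∏ i, f i (τ i) = ∏ i, (f i 1 + f i (-1)) := by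
    intro f
    have h := (Finset.prod_univ_sum (fun _ : ι => (Finset.univ : Finset ℤˣ)) f).symm
    rw [Fintype.piFinset_univ] at h
    rw [h]
    refine Finset.prod_congr rfl fun i _ => ?_
    rw [show (Finset.univ : Finset ℤˣ) = {1, -1} from rfl, Finset.sum_pair (by decide)]
  have hcon : 0 ≤ contraction α K := by
    rcases eq_or_ne K 0 with rfl | h
    · simp [contraction]
    · exact (contraction_pos h0 h1 h).le
  -- The estimate with the unmarked spins fixed: signed and unsigned sums over `τ` both factorize
  -- over the marked edges, and the factors are compared one by one.
  have key : ∀ σ, ∑ τ : ι → ℤˣ, ε (σ * extendSpin g τ) * W (σ * extendSpin g τ) ≤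
      contraction α K ^ Fintype.card ι * ∑ τ : ι → ℤˣ, W (σ * extendSpin g τ) := by
    intro σ
    have e1 : ∑ τ : ι → ℤˣ, ε (σ * extendSpin g τ) * W (σ * extendSpin g τ) =
        ε σ * F σ none 1 * ∏ i, (F σ (some i) 1 - F σ (some i) (-1)) := by
      have := hsum fun i u => ((u : ℤ) : ℝ) * F σ (some i) u
      simp only [Units.val_one, Units.val_neg, Int.cast_one, Int.cast_neg, one_mul, neg_mul,
        ← sub_eq_add_neg] at this
      rw [← this, Finset.mul_sum]
      refine Finset.sum_congr rfl fun τ _ => ?_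
      rw [hε, hW, Finset.prod_mul_distrib]
      ring
    have e2 : ∑ τ : ι → ℤˣ, W (σ * extendSpin g τ) =
        F σ none 1 * ∏ i, (F σ (some i) 1 + F σ (some i) (-1)) := by
      rw [← hsum, Finset.mul_sum]
      exact Finset.sum_congr rfl fun τ _ => hW σ τ
    rw [e1, e2]
    have hε1 : |ε σ| = 1 := by
      simp only [ε, Finset.abs_prod]
      refine Finset.prod_eq_one fun e _ => ?_
      rcases Int.units_eq_one_or (σ e) with h | h <;> simp [h]
    calc ε σ * F σ none 1 * ∏ i, (F σ (some i) 1 - F σ (some i) (-1))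
        ≤ |ε σ * F σ none 1 * ∏ i, (F σ (some i) 1 - F σ (some i) (-1))| := le_abs_self _
      _ = F σ none 1 * ∏ i, |F σ (some i) 1 - F σ (some i) (-1)| := by
          rw [abs_mul, abs_mul, hε1, one_mul, abs_of_pos (hF _ _ _), Finset.abs_prod]
      _ ≤ F σ none 1 * ∏ i, (contraction α K * (F σ (some i) 1 + F σ (some i) (-1))) := by
          refine mul_le_mul_of_nonneg_left ?_ (hF _ _ _).le
          refine Finset.prod_le_prod (fun _ _ => abs_nonneg _) fun i _ => ?_
          have b := fun u : ℤˣ => prod_one_add_mem h0 h1 _ (hK i) fun p => flux inc p σ * u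
          exact abs_sub_le_contraction h0 h1 (b 1).1 (b 1).2 (b (-1)).1 (b (-1)).2
      _ = _ := by
          rw [Finset.prod_mul_distrib, Finset.prod_const, Finset.card_univ]
          ring
  have h2 := Finset.sum_le_sum fun (σ : E → ℤˣ) (_ : σ ∈ Finset.univ) => key σ
  rw [← Finset.mul_sum, hshift (fun σ => ε σ * W σ), hshift W, sum_prod_mul_spinWeight,
    sum_spinWeight] at h2
  have hc : (0 : ℝ) < Fintype.card (ι → ℤˣ) * 2 ^ Fintype.card E := by
    have : 0 < Fintype.card (ι → ℤˣ) := Fintype.card_pos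
    positivity
  refine le_of_mul_le_mul_left ?_ hc
  linarith

lemma one_le_evenSum [Fintype P] (inc : P → E → Prop) {α : ℝ} (h0 : 0 < α) :
    1 ≤ evenSum inc α := by
  have h : (∅ : Finset P) ∈ (Finset.univ : Finset (Finset P)).filter
      (fun c => ∀ e, Even (incCount inc c e)) :=
    Finset.mem_filter.2 ⟨Finset.mem_univ _, fun e => by simp [incCount]⟩
  calc (1 : ℝ) = α ^ (∅ : Finset P).card := by simp
    _ ≤ _ := Finset.single_le_sum (f := fun c => α ^ c.card) (fun c _ => (pow_pos h0 _).le) h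

lemma sum_pow_le_oddSum [Fintype P] (inc : P → E → Prop) {α : ℝ} (h0 : 0 < α)
    (s : Finset (Finset P)) (hs : ∀ c ∈ s, ∀ e, Odd (incCount inc c e)) :
    ∑ c ∈ s, α ^ c.card ≤ oddSum inc α :=
  Finset.sum_le_sum_of_subset_of_nonneg
    (fun c hc => Finset.mem_filter.2 ⟨Finset.mem_univ _, hs c hc⟩) fun _ _ _ => (pow_pos h0 _).le

end Abstract

/-! ### Tensor products of Pauli operators -/

section Operators

open scoped Classical

variable {S : Type} [Fintype S]

lemma tensorOp_mul (A B : S → Matrix (Fin 2) (Fin 2) ℂ) :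
    tensorOp A * tensorOp B = tensorOp fun s => A s * B s := by
  ext σ τ
  simp only [tensorOp, Matrix.mul_apply, Matrix.of_apply, ← Finset.prod_mul_distrib]
  have h := Finset.prod_univ_sum (fun _ : S => (Finset.univ : Finset (Fin 2)))
    (fun s r => A s (σ s) r * B s r (τ s))
  rw [Fintype.piFinset_univ] at h
  exact h.symm

lemma tensorOp_one : tensorOp (fun _ : S => (1 : Matrix (Fin 2) (Fin 2) ℂ)) = 1 := by
  ext σ τ
  simp only [tensorOp, Matrix.of_apply, Matrix.one_apply]
  split_ifs with h
  · simp [h]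
  · obtain ⟨s, hs⟩ := Function.ne_iff.1 h
    exact Finset.prod_eq_zero (Finset.mem_univ s) (by simp [hs])

lemma trace_tensorOp (A : S → Matrix (Fin 2) (Fin 2) ℂ) :
    (tensorOp A).trace = ∏ s, (A s).trace := by
  simp only [Matrix.trace, Matrix.diag, tensorOp, Matrix.of_apply]
  have h := Finset.prod_univ_sum (fun _ : S => (Finset.univ : Finset (Fin 2)))
    (fun s r => A s r r)
  rw [Fintype.piFinset_univ] at h
  exact h.symm

lemma tensorOp_smul (ε : S → ℂ) (A : S → Matrix (Fin 2) (Fin 2) ℂ) :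
    tensorOp (fun s => ε s • A s) = (∏ s, ε s) • tensorOp A := by
  ext σ τ
  simp [tensorOp, Finset.prod_mul_distrib]

lemma pauli_mul_self (a : Axis) : pauli a * pauli a = 1 := by
  cases a <;> ext i j <;> fin_cases i <;> fin_cases j <;> simp [pauli, Matrix.mul_apply]

lemma pauli_mul_comm {a b : Axis} (h : a ≠ b) : pauli a * pauli b = -(pauli b * pauli a) := by
  cases a <;> cases b <;> first | exact absurd rfl h | skip
  all_goals
    ext i j
    fin_cases i <;> fin_cases j <;> simp [pauli, Matrix.mul_apply]

lemma pauliOn_mul_self (a : Axis) (T : Set S) : pauliOn a T * pauliOn a T = 1 := by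
  rw [pauliOn, tensorOp_mul, ← tensorOp_one]
  congr 1
  funext s
  split_ifs <;> simp [pauli_mul_self]

lemma pauliOn_commute_same (a : Axis) (T T' : Set S) :
    Commute (pauliOn a T) (pauliOn a T') := by
  rw [Commute, SemiconjBy, pauliOn, pauliOn, tensorOp_mul, tensorOp_mul]
  congr 1
  funext s
  split_ifs <;> simp

/-- Different Pauli matrices anticommute, so exchanging the operators produces one sign per common
qubit. -/
lemma pauliOn_commute {a b : Axis} (h : a ≠ b) (T T' : Set S)
    (hT : Even (Finset.univ.filter fun s => s ∈ T ∧ s ∈ T').card) :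
    Commute (pauliOn a T) (pauliOn b T') := by
  rw [Commute, SemiconjBy, pauliOn, pauliOn, tensorOp_mul, tensorOp_mul]
  have h1 : (fun s => (if s ∈ T then pauli a else 1) * (if s ∈ T' then pauli b else 1)) =
      fun s => (if s ∈ T ∧ s ∈ T' then (-1 : ℂ) else 1) •
        ((if s ∈ T' then pauli b else 1) * (if s ∈ T then pauli a else 1)) := by
    funext s
    by_cases h1 : s ∈ T <;> by_cases h2 : s ∈ T' <;> simp [h1, h2, pauli_mul_comm h]
  rw [h1, tensorOp_smul, Finset.prod_ite, Finset.prod_const, Finset.prod_const_one, mul_one,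
    hT.neg_one_pow, one_smul]

/-- Even powers of `B` are `1` and odd powers are `B`, so the exponential series splits into those
of `cosh` and `sinh`. -/
lemma exp_smul_of_mul_self_eq_one {A : Type*} [NormedRing A] [NormedAlgebra ℂ A] [CompleteSpace A]
    {B : A} (hB : B * B = 1) (θ : ℂ) :
    NormedSpace.exp (θ • B) = Complex.cosh θ • (1 : A) + Complex.sinh θ • B := by
  have hev : ∀ k : ℕ, B ^ (2 * k) = 1 := fun k => by rw [pow_mul, sq, hB, one_pow]
  have h1 : HasSum (fun k : ℕ => ((Nat.factorial (2 * k) : ℂ)⁻¹) • (θ • B) ^ (2 * k))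
      (Complex.cosh θ • (1 : A)) := by
    convert (Complex.hasSum_cosh θ).smul_const (1 : A) using 2 with k
    rw [smul_pow, hev, smul_smul, div_eq_inv_mul]
  have h2 : HasSum (fun k : ℕ => ((Nat.factorial (2 * k + 1) : ℂ)⁻¹) • (θ • B) ^ (2 * k + 1))
      (Complex.sinh θ • B) := by
    convert (Complex.hasSum_sinh θ).smul_const B using 2 with k
    rw [smul_pow, pow_succ B, hev, one_mul, smul_smul, div_eq_inv_mul]
  exact (NormedSpace.exp_series_hasSum_exp' (𝕂 := ℂ) (θ • B)).unique
    (HasSum.even_add_odd (f := fun n : ℕ => ((Nat.factorial n : ℂ)⁻¹) • (θ • B) ^ n) h1 h2)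

open scoped Matrix.Norms.Operator in
lemma exp_smul_op {B : Op S} (hB : B * B = 1) (θ : ℂ) :
    NormedSpace.exp (θ • B) = Complex.cosh θ • (1 : Op S) + Complex.sinh θ • B :=
  exp_smul_of_mul_self_eq_one hB θ

/-- The exponential of a sum of products of Pauli operators of one type. -/
lemma exp_sum_pauliOn {Q : Type} (a : Axis) (T : Q → Set S) (θ : ℝ) (s : Finset Q) :
    NormedSpace.exp ((θ : ℂ) • ∑ q ∈ s, pauliOn a (T q)) =
      (Real.cosh θ : ℂ) ^ s.card • ∑ c ∈ s.powerset, (Real.tanh θ : ℂ) ^ c.card •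
        tensorOp fun v => pauli a ^ incCount (fun q v => v ∈ T q) c v := by
  induction s using Finset.induction_on with
  | empty => simp [incCount, tensorOp_one, NormedSpace.exp_zero]
  | insert q s hq ih =>
    have hc : Commute ((θ : ℂ) • pauliOn a (T q)) ((θ : ℂ) • ∑ q ∈ s, pauliOn a (T q)) :=
      ((Commute.sum_right _ _ _ fun r _ => pauliOn_commute_same a _ _).smul_left _).smul_right _
    rw [Finset.sum_insert hq, smul_add, Matrix.exp_add_of_commute _ _ hc, ih,
      exp_smul_op (pauliOn_mul_self a _), Finset.sum_powerset_insert hq,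
      Finset.card_insert_of_notMem hq]
    have hcosh : (Real.cosh θ : ℂ) ≠ 0 := by exact_mod_cast (Real.cosh_pos θ).ne'
    have hfac : Complex.cosh θ • (1 : Op S) + Complex.sinh θ • pauliOn a (T q) =
        (Real.cosh θ : ℂ) • (1 + (Real.tanh θ : ℂ) • pauliOn a (T q)) := by
      rw [smul_add, smul_smul]
      congr 2
      · simp
      · rw [Real.tanh_eq_sinh_div_cosh]
        push_cast
        push_cast at hcosh
        field_simp
    rw [hfac, smul_mul_smul_comm, pow_succ', add_mul, one_mul, smul_mul_assoc, Finset.mul_sum]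
    congr 2
    rw [Finset.smul_sum]
    refine Finset.sum_congr rfl fun c hcs => ?_
    have hqc : q ∉ c := fun h => hq (Finset.mem_powerset.1 hcs h)
    rw [Finset.card_insert_of_notMem hqc, mul_smul_comm, smul_smul, pow_succ', pauliOn,
      tensorOp_mul]
    congr 2
    funext v
    simp only [incCount, Finset.filter_insert]
    split_ifs with hv
    · rw [Finset.card_insert_of_notMem (by simp [hqc]), pow_succ']
    · rw [one_mul]

lemma pauli_pow (a : Axis) (k : ℕ) : pauli a ^ k = if Even k then 1 else pauli a := by
  split_ifs with h
  · obtain ⟨m, rfl⟩ := h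
    rw [← two_mul, pow_mul, sq, pauli_mul_self, one_pow]
  · obtain ⟨m, rfl⟩ := Nat.not_even_iff_odd.1 h
    rw [pow_succ, pow_mul, sq, pauli_mul_self, one_pow, one_mul]

omit [Fintype S] in
lemma exponent_eq (β J : ℝ) (B : Op S) :
    -(β : ℂ) • (-(J : ℂ) • B) = ((β * J : ℝ) : ℂ) • B := by
  rw [smul_smul]
  congr 1
  push_cast
  ring

/-- The normalized trace of the product of powers of the Pauli matrices. -/
def localTrace (f : Axis → ℕ) : ℂ :=
  (pauli Axis.x ^ f Axis.x * pauli Axis.y ^ f Axis.y * pauli Axis.z ^ f Axis.z).trace / 2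

lemma sum_axis {M : Type*} [AddCommMonoid M] (f : Axis → M) :
    ∑ a, f a = f Axis.x + f Axis.y + f Axis.z := by
  rw [show (Finset.univ : Finset Axis) = {Axis.x, Axis.y, Axis.z} from rfl,
    Finset.sum_insert (by decide), Finset.sum_insert (by decide), Finset.sum_singleton, add_assoc]

/-- Functions on the three axes are triples. -/
def axisPiEquiv (X : Axis → Type) : (∀ a, X a) ≃ X Axis.x × X Axis.y × X Axis.z where
  toFun f := (f Axis.x, f Axis.y, f Axis.z)
  invFun t a := match a with
    | Axis.x => t.1
    | Axis.y => t.2.1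
    | Axis.z => t.2.2
  left_inv f := by
    funext a
    cases a <;> rfl
  right_inv t := rfl

/-- The normalized partition function of a sum of products of Pauli matrices `σ^z`. -/
lemma normalizedPartitionFunction_pauli_z {Q : Type} [Fintype Q] (β J : ℝ) (T : Q → Set S) :
    normalizedPartitionFunction β (-(J : ℂ) • ∑ q, pauliOn Axis.z (T q)) =
      (Real.cosh (β * J) : ℂ) ^ Fintype.card Q * ∑ c : Finset Q,
        if ∀ e, Even (incCount (fun q e => e ∈ T q) c e) then (Real.tanh (β * J) : ℂ) ^ c.card
        else 0 := by
  rw [normalizedPartitionFunction, partitionFunction, exponent_eq, exp_sum_pauliOn]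
  -- The trace factorizes over the sites, where `σ^z` is traceless and the identity has trace `2`.
  have htr : ∀ c : Finset Q,
      (tensorOp fun e => pauli Axis.z ^ incCount (fun q e => e ∈ T q) c e).trace =
        if ∀ e, Even (incCount (fun q e => e ∈ T q) c e) then (2 : ℂ) ^ Fintype.card S else 0 := by
    intro c
    rw [trace_tensorOp]
    split_ifs with h
    · rw [Finset.prod_congr rfl fun e _ => by
        rw [pauli_pow, if_pos (h e), Matrix.trace_one, Fintype.card_fin]]
      simp
    · obtain ⟨e, he⟩ := not_forall.1 h
      refine Finset.prod_eq_zero (Finset.mem_univ e) ?_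
      rw [pauli_pow, if_neg he]
      simp [pauli, Matrix.trace]
  rw [Matrix.trace_smul, Matrix.trace_sum, Finset.powerset_univ]
  simp only [Matrix.trace_smul, htr]
  rw [smul_eq_mul, mul_div_assoc, Finset.sum_div, Finset.card_univ]
  congr 1
  refine Finset.sum_congr rfl fun c _ => ?_
  split_ifs <;> simp

/-- The normalized partition function of a sum of commuting products of Pauli matrices of the
three types. -/
lemma normalizedPartitionFunction_pauli {Q : Axis → Type} [∀ a, Fintype (Q a)] (β J : ℝ)
    (T : ∀ a, Q a → Set S) (hT : ∀ a b, a ≠ b → ∀ p q,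
      Even (Finset.univ.filter fun s => s ∈ T a p ∧ s ∈ T b q).card) :
    normalizedPartitionFunction β (-(J : ℂ) • ∑ a, ∑ q : Q a, pauliOn a (T a q)) =
      (Real.cosh (β * J) : ℂ) ^ (∑ a, Fintype.card (Q a)) *
        ∑ f : ∀ a, Finset (Q a), (Real.tanh (β * J) : ℂ) ^ (∑ a, (f a).card) *
          ∏ v, localTrace fun a => incCount (fun q v => v ∈ T a q) (f a) v := by
  set θ := β * J with hθ
  set B : Axis → Op S := fun a => ∑ q : Q a, pauliOn a (T a q) with hB
  have hcomm : ∀ a b, a ≠ b → Commute ((θ : ℂ) • B a) ((θ : ℂ) • B b) := by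
    intro a b hab
    refine (Commute.smul_left ?_ _).smul_right _
    exact Commute.sum_left _ _ _ fun p _ => Commute.sum_right _ _ _ fun q _ =>
      pauliOn_commute hab _ _ (hT a b hab p q)
  have hexp : NormedSpace.exp ((θ : ℂ) • ∑ a, B a) =
      NormedSpace.exp ((θ : ℂ) • B Axis.x) * NormedSpace.exp ((θ : ℂ) • B Axis.y) *
        NormedSpace.exp ((θ : ℂ) • B Axis.z) := by
    rw [sum_axis, smul_add, smul_add, Matrix.exp_add_of_commute, Matrix.exp_add_of_commute]
    · exact hcomm _ _ (by decide)
    · exact (hcomm _ _ (by decide)).add_left (hcomm _ _ (by decide))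
  rw [normalizedPartitionFunction, partitionFunction, exponent_eq, ← hθ, hexp]
  simp only [hB, exp_sum_pauliOn, Finset.powerset_univ]
  rw [smul_mul_smul_comm, smul_mul_smul_comm, ← pow_add, ← pow_add, Matrix.trace_smul,
    smul_eq_mul, mul_div_assoc, sum_axis]
  simp only [Finset.card_univ]
  congr 1
  rw [Fintype.sum_equiv (axisPiEquiv fun a => Finset (Q a)) _ (fun t =>
      ((((θ.tanh : ℂ) ^ t.1.card • tensorOp fun v => pauli Axis.x ^ incCount
          (fun q v => v ∈ T Axis.x q) t.1 v) *
        ((θ.tanh : ℂ) ^ t.2.1.card • tensorOp fun v => pauli Axis.y ^ incCount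
          (fun q v => v ∈ T Axis.y q) t.2.1 v) *
        ((θ.tanh : ℂ) ^ t.2.2.card • tensorOp fun v => pauli Axis.z ^ incCount
          (fun q v => v ∈ T Axis.z q) t.2.2 v)).trace) / 2 ^ Fintype.card S)
      (fun f => ?_), Fintype.sum_prod_type]
  · rw [Finset.sum_mul_sum, Finset.sum_mul, Matrix.trace_sum, Finset.sum_div]
    refine Finset.sum_congr rfl fun cx _ => ?_
    rw [Finset.sum_mul_sum, Matrix.trace_sum, Finset.sum_div, Fintype.sum_prod_type]
    refine Finset.sum_congr rfl fun cy _ => ?_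
    rw [Matrix.trace_sum, Finset.sum_div]
  · rw [smul_mul_smul_comm, smul_mul_smul_comm, ← pow_add, ← pow_add, tensorOp_mul, tensorOp_mul,
      Matrix.trace_smul, trace_tensorOp, smul_eq_mul, mul_div_assoc, sum_axis]
    simp only [localTrace, Finset.prod_div_distrib, Finset.prod_const, Finset.card_univ]
    rfl

end Operators

/-! ### The local structure of the honeycomb -/

section Local

variable {L : Fin 3 → ℕ+}

lemma res_add (p q : Torus L) : res (p + q) = res p + res q := by
  funext i
  simp [res]

lemma res_sub (p q : Torus L) : res (p - q) = res p - res q := by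
  funext i
  simp [res]

/-- The unit step in direction `i` with sign `t`. -/
def unitStep (L : Fin 3 → ℕ+) (i : Fin 3) (t : ℤˣ) : Torus L :=
  Pi.single i (((t : ℤ) : ZMod (4 * (L i : ℕ))))

lemma res_unitStep (i : Fin 3) (t : ℤˣ) (m : Fin 3) :
    res (unitStep L i t) m = if m = i then (((t : ℤ)) : ZMod 4) else 0 := by
  rw [res, unitStep]
  split_ifs with h
  · subst h
    simp
  · simp [Pi.single_eq_of_ne h]

lemma unitStep_neg (i : Fin 3) (t : ℤˣ) : unitStep L i (-t) = -unitStep L i t := by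
  simp [unitStep, Pi.single_neg]

lemma isAxialStep_iff {d : Torus L} : IsAxialStep d ↔ ∃ i t, d = unitStep L i t := Iff.rfl

lemma isDiagonalStep_iff {d : Torus L} :
    IsDiagonalStep d ↔ ∃ i j s t, i ≠ j ∧ d = unitStep L i s + unitStep L j t := Iff.rfl

lemma IsDiagonalStep.neg {d : Torus L} (h : IsDiagonalStep d) : IsDiagonalStep (-d) := by
  obtain ⟨i, j, s, t, hij, rfl⟩ := h
  exact ⟨i, j, -s, -t, hij, by simp [Pi.single_neg]; abel⟩

/-- A vector with all coordinates in `{0, 1, -1}`. -/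
def IsSmall (d : Torus L) : Prop :=
  ∀ m, d m = 0 ∨ ∃ t : ℤˣ, d m = ((t : ℤ) : ZMod (4 * (L m : ℕ)))

lemma IsAxialStep.isSmall {d : Torus L} (h : IsAxialStep d) : IsSmall d := by
  obtain ⟨i, t, rfl⟩ := h
  intro m
  rcases eq_or_ne m i with rfl | hm
  · exact Or.inr ⟨t, by simp⟩
  · exact Or.inl (by simp [hm])

lemma IsDiagonalStep.isSmall {d : Torus L} (h : IsDiagonalStep d) : IsSmall d := by
  obtain ⟨i, j, s, t, hij, rfl⟩ := h
  intro m
  rcases eq_or_ne m i with rfl | hm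
  · exact Or.inr ⟨s, by simp [hij]⟩
  rcases eq_or_ne m j with rfl | hm'
  · exact Or.inr ⟨t, by simp [hm]⟩
  · exact Or.inl (by simp [hm, hm'])

lemma res_eq_zero {d : Torus L} {m : Fin 3} (h : d m = 0) : res d m = 0 := by
  rw [res, h, map_zero]

lemma res_eq_unit {d : Torus L} {m : Fin 3} {t : ℤˣ}
    (h : d m = ((t : ℤ) : ZMod (4 * (L m : ℕ)))) : res d m = ((t : ℤ) : ZMod 4) := by
  rw [res, h, map_intCast]

/-- The obstruction used to show that a vertex does not lie on a plaquette: a coordinate of their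
difference is `2` modulo `4`. -/
lemma IsSmall.res_ne_two {d : Torus L} (h : IsSmall d) (m : Fin 3) : res d m ≠ 2 := by
  rcases h m with h | ⟨t, h⟩
  · rw [res_eq_zero h]
    decide
  · rw [res_eq_unit h]
    clear * -
    revert t
    decide

/-- The values `0`, `1`, `-1` are already distinct modulo `4`. This is why even the torus with `L i
= 1` creates no coincidences between steps. -/
lemma IsSmall.ext {d d' : Torus L} (h : IsSmall d) (h' : IsSmall d') (hr : res d = res d') :
    d = d' := by
  funext m
  have hm := congrFun hr m
  rcases h m with h | ⟨t, h⟩ <;> rcases h' m with h' | ⟨t', h'⟩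
  · rw [h, h']
  · rw [res_eq_zero h, res_eq_unit h'] at hm
    exact absurd hm (by clear * -; revert t'; decide)
  · rw [res_eq_unit h, res_eq_zero h'] at hm
    exact absurd hm (by clear * -; revert t; decide)
  · rw [res_eq_unit h, res_eq_unit h'] at hm
    have : t = t' := by clear * - hm; revert t t'; decide
    rw [h, h', this]

/-- Coordinates `i, j, k` in which the vertex `v` is `0`, `2` and `s` modulo `4`. -/
structure IsFrame (v : Torus L) (i j k : Fin 3) (s : ℤˣ) : Prop where
  hij : i ≠ j
  hik : i ≠ k
  hjk : j ≠ k
  res_i : res v i = 0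
  res_j : res v j = 2
  res_k : res v k = ((s : ℤ) : ZMod 4)

lemma eq_or_of_distinct : ∀ {i j k : Fin 3}, i ≠ j → i ≠ k → j ≠ k →
    ∀ m, m = i ∨ m = j ∨ m = k := by decide

lemma exists_perm_of_distinct : ∀ i j k : Fin 3, i ≠ j → i ≠ k → j ≠ k →
    ∃ π : Equiv.Perm (Fin 3), π 0 = i ∧ π 1 = j ∧ π 2 = k := by decide

lemma odd_residue_iff : ∀ r : ZMod 4, (r = 1 ∨ r = 3) ↔ ∃ s : ℤˣ, r = ((s : ℤ) : ZMod 4) := by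
  decide

lemma isVertex_iff {v : Torus L} : IsVertex v ↔ ∃ i j k s, IsFrame v i j k s := by
  constructor
  · rintro ⟨π, h0, h1, h2⟩
    obtain ⟨s, hs⟩ := (odd_residue_iff _).1 h2
    exact ⟨π 0, π 1, π 2, s, by simp, by simp, by simp, h0, h1, hs⟩
  · rintro ⟨i, j, k, s, h⟩
    obtain ⟨π, rfl, rfl, rfl⟩ := exists_perm_of_distinct i j k h.hij h.hik h.hjk
    exact ⟨π, h.res_i, h.res_j, (odd_residue_iff _).2 ⟨s, h.res_k⟩⟩

lemma ncard_res_eq_three {i j k : Fin 3} (hij : i ≠ j) (hik : i ≠ k) (hjk : j ≠ k)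
    (r : Fin 3 → ZMod 4) : Set.ncard {m | r m = 3} =
      (if r i = 3 then 1 else 0) + (if r j = 3 then 1 else 0) + (if r k = 3 then 1 else 0) := by
  rw [Set.ncard_eq_toFinset_card', Set.toFinset_ofPred, Finset.card_filter]
  obtain ⟨π, rfl, rfl, rfl⟩ := exists_perm_of_distinct i j k hij hik hjk
  rw [← Equiv.sum_comp π, Fin.sum_univ_three]

variable {v : Torus L} {i j k : Fin 3} {s : ℤˣ}

namespace IsFrame

/-- The residues of the point reached from the vertex `v` by a step in directions `i` and `j`. -/
lemma res_hexagon (h : IsFrame v i j k s) (t t' : ℤˣ) :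
    res (v + unitStep L i t + unitStep L j t') i = ((t : ℤ) : ZMod 4) ∧
    res (v + unitStep L i t + unitStep L j t') j = 2 + ((t' : ℤ) : ZMod 4) ∧
    res (v + unitStep L i t + unitStep L j t') k = ((s : ℤ) : ZMod 4) := by
  simp [res_add, res_unitStep, h.hij, h.hij.symm, h.hik.symm, h.hjk.symm, h.res_i, h.res_j, h.res_k]

lemma isHexagonCentre (h : IsFrame v i j k s) (t t' : ℤˣ) :
    IsHexagonCentre (v + unitStep L i t + unitStep L j t') := by
  obtain ⟨h1, h2, h3⟩ := h.res_hexagon t t'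
  intro m
  rw [odd_residue_iff]
  rcases eq_or_of_distinct h.hij h.hik h.hjk m with rfl | rfl | rfl
  · exact ⟨t, h1⟩
  · exact ⟨-t', h2.trans (by clear * -; revert t'; decide)⟩
  · exact ⟨s, h3⟩

/-- Since `2 + t' = -t'` modulo `4`, the centre has signs `t`, `-t'`, `s`; it is of type X exactly
when their product is `1`. -/
lemma isCentre_x_iff (h : IsFrame v i j k s) (t t' : ℤˣ) :
    IsCentre Axis.x (v + unitStep L i t + unitStep L j t') ↔ t' = -(s * t) := by
  obtain ⟨h1, h2, h3⟩ := h.res_hexagon t t'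
  simp only [IsCentre, h.isHexagonCentre t t', true_and]
  rw [ncard_res_eq_three h.hij h.hik h.hjk, h1, h2, h3]
  clear * -
  revert s t t'
  decide

lemma isCentre_z_iff (h : IsFrame v i j k s) (t t' : ℤˣ) :
    IsCentre Axis.z (v + unitStep L i t + unitStep L j t') ↔ t' = s * t := by
  obtain ⟨h1, h2, h3⟩ := h.res_hexagon t t'
  simp only [IsCentre, h.isHexagonCentre t t', true_and]
  rw [ncard_res_eq_three h.hij h.hik h.hjk, h1, h2, h3]
  clear * -
  revert s t t'
  decide

/-- The coordinates `i` and `j` of `v` are even and those of `q` are odd, so the diagonal step must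
use exactly these two directions. -/
lemma exists_of_hexagon (h : IsFrame v i j k s) {q : Torus L} (hq : IsHexagonCentre q)
    (hd : IsDiagonalStep (v - q)) :
    ∃ t t', q = v + unitStep L i t + unitStep L j t' := by
  obtain ⟨m, m', a, b, hm, e⟩ := isDiagonalStep_iff.1 hd
  have e' : q = v + unitStep L m (-a) + unitStep L m' (-b) := by
    rw [unitStep_neg, unitStep_neg, add_assoc, ← neg_add, ← e]
    abel
  have hi := hq i
  have hj := hq j
  rw [e', res_add, res_add] at hi hj
  simp only [Pi.add_apply, res_unitStep, h.res_i, h.res_j] at hi hj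
  have hi' : i = m ∨ i = m' := by
    by_contra! hc
    rw [if_neg hc.1, if_neg hc.2] at hi
    exact absurd hi (by decide)
  have hj' : j = m ∨ j = m' := by
    by_contra! hc
    rw [if_neg hc.1, if_neg hc.2] at hj
    exact absurd hj (by decide)
  rcases hi' with rfl | rfl
  · obtain rfl := hj'.resolve_left h.hij.symm
    exact ⟨_, _, e'⟩
  · obtain rfl := hj'.resolve_right h.hij.symm
    exact ⟨-b, -a, by rw [e']; abel⟩

lemma isDiagonalStep_sub (h : IsFrame v i j k s) (t t' : ℤˣ) :
    IsDiagonalStep (v - (v + unitStep L i t + unitStep L j t')) := by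
  refine isDiagonalStep_iff.2 ⟨i, j, -t, -t', h.hij, ?_⟩
  rw [unitStep_neg, unitStep_neg]
  abel

lemma isSquareCentre (h : IsFrame v i j k s) (t : ℤˣ) :
    IsSquareCentre (v + unitStep L k t) := by
  have hi : res (v + unitStep L k t) i = 0 := by
    simp [res_add, res_unitStep, h.hik, h.res_i]
  have hj : res (v + unitStep L k t) j = 2 := by
    simp [res_add, res_unitStep, h.hjk, h.res_j]
  have hk : res (v + unitStep L k t) k = ((s : ℤ) : ZMod 4) + ((t : ℤ) : ZMod 4) := by
    simp [res_add, res_unitStep, h.res_k]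
  refine ⟨fun m => ?_, i, j, ?_⟩
  · rcases eq_or_of_distinct h.hij h.hik h.hjk m with rfl | rfl | rfl
    · exact Or.inl hi
    · exact Or.inr hj
    · rw [hk]
      clear * -
      revert s t
      decide
  · rw [hi, hj]
    decide

lemma exists_of_square (h : IsFrame v i j k s) {q : Torus L} (hq : IsSquareCentre q)
    (hd : IsAxialStep (v - q)) : ∃ t, q = v + unitStep L k t := by
  obtain ⟨m, a, e⟩ := isAxialStep_iff.1 hd
  have e' : q = v + unitStep L m (-a) := by
    rw [unitStep_neg, ← e]
    abel
  have hk := hq.1 k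
  rw [e', res_add] at hk
  simp only [Pi.add_apply, res_unitStep, h.res_k] at hk
  have : k = m := by
    by_contra hc
    rw [if_neg hc, add_zero] at hk
    clear * - hk
    revert s
    decide
  subst this
  exact ⟨_, e'⟩

/-- The centre of the `t`-th plaquette of type `a` at the vertex `v`. -/
def centre (_ : IsFrame v i j k s) : Axis → ℤˣ → Torus L
  -- The signs are chosen so that incidence with the four edges takes the form of `edgeIndex`,
  -- independent of `s`.
  | Axis.x, t => v + unitStep L i t + unitStep L j (-(s * t))
  | Axis.y, t => v + unitStep L k (-(s * t))
  | Axis.z, t => v + unitStep L i t + unitStep L j (s * t)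

lemma isCentre (h : IsFrame v i j k s) (a : Axis) (t : ℤˣ) : IsCentre a (h.centre a t) := by
  cases a
  · exact (h.isCentre_x_iff _ _).2 rfl
  · exact h.isSquareCentre _
  · exact (h.isCentre_z_iff _ _).2 rfl

/-- The `t`-th plaquette of type `a` at the vertex `v`. -/
def plaquette (h : IsFrame v i j k s) (a : Axis) (t : ℤˣ) : PlaquetteOf L a :=
  ⟨h.centre a t, h.isCentre a t⟩

lemma unitStep_injective (i : Fin 3) : Function.Injective (unitStep L i) := by
  intro t u htu
  have := congrFun (congrArg res htu) i
  simp only [res_unitStep, if_true] at this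
  clear * - this
  revert t u
  decide

lemma plaquette_injective (h : IsFrame v i j k s) (a : Axis) :
    Function.Injective (h.plaquette a) := by
  intro t u htu
  have hc : h.centre a t = h.centre a u := congrArg Subtype.val htu
  have hr := congrArg res hc
  cases a
  · have := congrFun hr i
    simp only [centre, (h.res_hexagon _ _).1] at this
    clear * - this
    revert t u
    decide
  · have := unitStep_injective k (add_left_cancel hc)
    simpa using this
  · have := congrFun hr i
    simp only [centre, (h.res_hexagon _ _).1] at this
    clear * - this
    revert t u
    decide

lemma mem_plaquetteVertices (h : IsFrame v i j k s) (hv : IsVertex v) (a : Axis)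
    (q : PlaquetteOf L a) :
    (⟨v, hv⟩ : Vertex L) ∈ plaquetteVertices ⟨a, q⟩ ↔ ∃ t, q = h.plaquette a t := by
  obtain ⟨q, hq⟩ := q
  simp only [plaquette, Subtype.mk.injEq]
  cases a
  · constructor
    · intro hd
      obtain ⟨t, t', rfl⟩ := h.exists_of_hexagon hq.1 hd
      obtain rfl := (h.isCentre_x_iff t t').1 hq
      exact ⟨t, rfl⟩
    · rintro ⟨t, rfl⟩
      exact h.isDiagonalStep_sub _ _
  · constructor
    · intro hd
      obtain ⟨t, rfl⟩ := h.exists_of_square hq hd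
      refine ⟨-(s * t), ?_⟩
      simp [centre, ← mul_assoc]
    · rintro ⟨t, rfl⟩
      refine isAxialStep_iff.2 ⟨k, s * t, ?_⟩
      simp [centre, unitStep_neg]
  · constructor
    · intro hd
      obtain ⟨t, t', rfl⟩ := h.exists_of_hexagon hq.1 hd
      obtain rfl := (h.isCentre_z_iff t t').1 hq
      exact ⟨t, rfl⟩
    · rintro ⟨t, rfl⟩
      exact h.isDiagonalStep_sub _ _

end IsFrame

end Local

/-- The index of the plaquette of type `a` at the edge with indices `t`, `u`. -/
def edgeIndex : Axis → ℤˣ → ℤˣ → ℤˣ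
  | Axis.x, t, _ => t
  | Axis.y, _, u => u
  | Axis.z, t, u => t * u

/-- The plaquettes and edges at a vertex: two plaquettes of each type and four edges, each edge
in one plaquette of each type. -/
structure VertexStar {L : Fin 3 → ℕ+} (v : Vertex L) where
  /-- The plaquettes of each type at the vertex. -/
  plaq : ∀ a, ℤˣ → PlaquetteOf L a
  /-- The edges at the vertex. -/
  edge : ℤˣ → ℤˣ → Edge L
  plaq_injective : ∀ a, Function.Injective (plaq a)
  mem_vertices : ∀ a q, v ∈ plaquetteVertices ⟨a, q⟩ ↔ ∃ t, q = plaq a t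
  mem_edge : ∀ e : Edge L, v ∈ e.1 ↔ ∃ t u, e = edge t u
  edge_mem : ∀ t u a q, edge t u ∈ plaquetteEdges ⟨a, q⟩ ↔ q = plaq a (edgeIndex a t u)

/-! ### The four edges at a vertex and their plaquettes -/

section Star

variable {L : Fin 3 → ℕ+} {v : Torus L} {i j k : Fin 3} {s : ℤˣ}

lemma edgeGraph_adj {v w : Vertex L} :
    (edgeGraph L).Adj v w ↔ v ≠ w ∧ IsDiagonalStep (w.1 - v.1) := by
  rw [edgeGraph, SimpleGraph.fromRel_adj]
  have : IsDiagonalStep (v.1 - w.1) ↔ IsDiagonalStep (w.1 - v.1) :=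
    ⟨fun h => by simpa using h.neg, fun h => by simpa using h.neg⟩
  rw [this, or_self]

namespace IsFrame

/-- The neighbours of the vertex `v`. -/
def neighbour (_ : IsFrame v i j k s) (t u : ℤˣ) : Torus L :=
  -- For `u = 1` the coordinate `k` moves to residue `0`, which frees `i` to become odd; for `u =
  -- -1` it moves to residue `2`, which frees `j`.
  if u = 1 then v + unitStep L k (-s) + unitStep L i t
  else v + unitStep L k s + unitStep L j (-(s * t))

lemma neighbour_one (h : IsFrame v i j k s) (t : ℤˣ) :
    h.neighbour t 1 = v + unitStep L k (-s) + unitStep L i t := if_pos rfl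

lemma neighbour_neg_one (h : IsFrame v i j k s) (t : ℤˣ) :
    h.neighbour t (-1) = v + unitStep L k s + unitStep L j (-(s * t)) :=
  if_neg (by decide)

lemma neighbour_frame_one (h : IsFrame v i j k s) (t : ℤˣ) :
    IsFrame (h.neighbour t 1) k j i t := by
  refine ⟨h.hjk.symm, h.hik.symm, h.hij.symm, ?_, ?_, ?_⟩ <;> rw [neighbour_one] <;>
    simp [res_add, res_unitStep, h.hij, h.hij.symm, h.hik, h.hik.symm, h.hjk, h.hjk.symm,
      h.res_i, h.res_j, h.res_k]

lemma neighbour_frame_neg_one (h : IsFrame v i j k s) (t : ℤˣ) :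
    IsFrame (h.neighbour t (-1)) i k j (s * t) := by
  refine ⟨h.hik, h.hij, h.hjk.symm, ?_, ?_, ?_⟩ <;> rw [neighbour_neg_one] <;>
    simp only [res_add, res_unitStep, h.hij, h.hij.symm, h.hik, h.hik.symm, h.hjk, h.hjk.symm,
      h.res_i, h.res_j, h.res_k, Pi.add_apply, if_true, if_false, add_zero]
  · clear * -
    revert s
    decide
  · clear * -
    revert s t
    decide

lemma isVertex_neighbour (h : IsFrame v i j k s) (t u : ℤˣ) : IsVertex (h.neighbour t u) := by
  rcases Int.units_eq_one_or u with rfl | rfl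
  · exact isVertex_iff.2 ⟨_, _, _, _, h.neighbour_frame_one t⟩
  · exact isVertex_iff.2 ⟨_, _, _, _, h.neighbour_frame_neg_one t⟩

lemma isDiagonalStep_neighbour (h : IsFrame v i j k s) (t u : ℤˣ) :
    IsDiagonalStep (h.neighbour t u - v) := by
  rcases Int.units_eq_one_or u with rfl | rfl
  · exact isDiagonalStep_iff.2 ⟨k, i, -s, t, h.hik.symm, by rw [neighbour_one]; abel⟩
  · exact isDiagonalStep_iff.2 ⟨k, j, s, -(s * t), h.hjk.symm, by rw [neighbour_neg_one]; abel⟩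

lemma neighbour_ne (h : IsFrame v i j k s) (t u : ℤˣ) : v ≠ h.neighbour t u := by
  intro e
  have hk := h.res_k
  rw [e] at hk
  rcases Int.units_eq_one_or u with rfl | rfl
  · rw [(h.neighbour_frame_one t).res_i] at hk
    clear * - hk
    revert s
    decide
  · rw [(h.neighbour_frame_neg_one t).res_j] at hk
    clear * - hk
    revert s
    decide

/-- The step must involve `k`, as otherwise all coordinates of `w` would be odd. The other direction
makes `i` or `j` odd, and `k` must then take over the lost residue, which fixes its sign. -/
lemma exists_neighbour (h : IsFrame v i j k s) {w : Torus L} (hw : IsVertex w)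
    (hd : IsDiagonalStep (w - v)) : ∃ t u, w = h.neighbour t u := by
  obtain ⟨m, m', a, b, hm, e⟩ := isDiagonalStep_iff.1 hd
  have e' : w = v + unitStep L m a + unitStep L m' b := by
    rw [add_assoc, ← e]
    abel
  obtain ⟨π, h0, h2, -⟩ := hw
  have eq3 := eq_or_of_distinct h.hij h.hik h.hjk
  have key : ∀ (m : Fin 3) (a b : ℤˣ), m ≠ k → w = v + unitStep L k b + unitStep L m a →
      ∃ t u, w = h.neighbour t u := by
    intro m a b hmk e
    rcases eq3 m with rfl | rfl | rfl
    · have hb : b = -s := by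
        have r0 : ∃ n, res w n = 0 := ⟨_, h0⟩
        rcases r0 with ⟨n, hn⟩
        rw [e] at hn
        rcases eq3 n with rfl | rfl | rfl <;>
        simp only [res_add, res_unitStep, h.hij, h.hij.symm, h.hik, h.hik.symm, h.hjk, h.hjk.symm,
          h.res_i, h.res_j, h.res_k, Pi.add_apply, if_true, if_false, add_zero] at hn <;>
        clear * - s a b hn <;> revert hn <;> revert s a b <;> decide
      exact ⟨a, 1, by rw [neighbour_one, e, hb]⟩
    · have hb : b = s := by
        have r0 : ∃ n, res w n = 2 := ⟨_, h2⟩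
        rcases r0 with ⟨n, hn⟩
        rw [e] at hn
        rcases eq3 n with rfl | rfl | rfl <;>
        simp only [res_add, res_unitStep, h.hij, h.hij.symm, h.hik, h.hik.symm, h.hjk, h.hjk.symm,
          h.res_i, h.res_j, h.res_k, Pi.add_apply, if_true, if_false, add_zero] at hn <;>
        clear * - s a b hn <;> revert hn <;> revert s a b <;> decide
      exact ⟨-(s * a), -1, by rw [neighbour_neg_one, e, hb]; simp [← mul_assoc]⟩
    · exact absurd rfl hmk
  by_cases hk : m = k
  · subst hk
    exact key m' b a hm.symm e'
  by_cases hk' : m' = k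
  · subst hk'
    exact key m a b hm (by rw [e']; abel)
  exfalso
  have r0 : ∃ n, res w n = 0 := ⟨_, h0⟩
  obtain ⟨n, hn⟩ := r0
  have hmi : m = i ∧ m' = j ∨ m = j ∧ m' = i := by
    rcases eq3 m with rfl | rfl | rfl <;> rcases eq3 m' with rfl | rfl | rfl <;> simp_all
  rw [e'] at hn
  rcases hmi with ⟨rfl, rfl⟩ | ⟨rfl, rfl⟩ <;> rcases eq3 n with rfl | rfl | rfl <;>
    simp only [res_add, res_unitStep, h.hij, h.hij.symm, h.hik, h.hik.symm, h.hjk, h.hjk.symm,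
      h.res_i, h.res_j, h.res_k, Pi.add_apply, if_true, if_false, add_zero, zero_add] at hn <;>
    clear * - s a b hn <;> revert hn <;> revert s a b <;> decide

/-- For any other index, some coordinate of the difference would be `2` modulo `4`. -/
lemma eq_edgeIndex (h : IsFrame v i j k s) {a : Axis} {t u r : ℤˣ}
    (hs : IsSmall (h.neighbour t u - h.centre a r)) : r = edgeIndex a t u := by
  have hi := hs.res_ne_two i
  have hj := hs.res_ne_two j
  have hk := hs.res_ne_two k
  rw [res_sub, Pi.sub_apply] at hi hj hk
  rcases Int.units_eq_one_or u with rfl | rfl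
  · rw [neighbour_one] at hi hj hk
    cases a <;>
    simp only [centre, res_add, res_unitStep, h.hij, h.hij.symm, h.hik, h.hik.symm, h.hjk,
      h.hjk.symm, h.res_i, h.res_j, h.res_k, Pi.add_apply, if_true, if_false, add_zero,
      zero_add] at hi hj hk <;>
    clear * - hi hj hk <;> revert s t r <;> decide
  · rw [neighbour_neg_one] at hi hj hk
    cases a <;>
    simp only [centre, res_add, res_unitStep, h.hij, h.hij.symm, h.hik, h.hik.symm, h.hjk,
      h.hjk.symm, h.res_i, h.res_j, h.res_k, Pi.add_apply, if_true, if_false, add_zero,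
      zero_add] at hi hj hk <;>
    clear * - hi hj hk <;> revert s t r <;> decide

lemma isSmall_of_mem {w : Vertex L} {a : Axis} {q : PlaquetteOf L a}
    (hw : w ∈ plaquetteVertices ⟨a, q⟩) : IsSmall (w.1 - q.1) := by
  cases a
  · exact IsDiagonalStep.isSmall hw
  · exact IsAxialStep.isSmall hw
  · exact IsDiagonalStep.isSmall hw

lemma neighbour_mem_iff (h : IsFrame v i j k s) (t u : ℤˣ) (a : Axis) (r : ℤˣ) :
    (⟨h.neighbour t u, h.isVertex_neighbour t u⟩ : Vertex L) ∈
      plaquetteVertices ⟨a, h.plaquette a r⟩ ↔ r = edgeIndex a t u := by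
  refine ⟨fun hw => h.eq_edgeIndex (isSmall_of_mem hw), ?_⟩
  rintro rfl
  rcases Int.units_eq_one_or u with rfl | rfl <;> cases a
  · refine isDiagonalStep_iff.2 ⟨k, j, -s, s * t, h.hjk.symm, ?_⟩
    simp only [neighbour_one, plaquette, centre, edgeIndex, unitStep_neg]
    abel
  · refine isAxialStep_iff.2 ⟨i, t, ?_⟩
    simp only [neighbour_one, plaquette, centre, edgeIndex, unitStep_neg, mul_one]
    abel
  · refine isDiagonalStep_iff.2 ⟨k, j, -s, -(s * t), h.hjk.symm, ?_⟩
    simp only [neighbour_one, plaquette, centre, edgeIndex, unitStep_neg, mul_one]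
    abel
  · refine isDiagonalStep_iff.2 ⟨k, i, s, -t, h.hik.symm, ?_⟩
    simp only [neighbour_neg_one, plaquette, centre, edgeIndex, unitStep_neg]
    abel
  · refine isAxialStep_iff.2 ⟨j, -(s * t), ?_⟩
    simp only [neighbour_neg_one, plaquette, centre, edgeIndex, unitStep_neg, mul_neg, mul_one,
      neg_neg]
    abel
  · refine isDiagonalStep_iff.2 ⟨k, i, s, t, h.hik.symm, ?_⟩
    simp only [neighbour_neg_one, plaquette, centre, edgeIndex, unitStep_neg, mul_neg, mul_one]
    abel

/-- The star of a vertex with given coordinates modulo `4`. -/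
def star (h : IsFrame v i j k s) (hv : IsVertex v) : VertexStar (⟨v, hv⟩ : Vertex L) where
  plaq := h.plaquette
  edge t u := ⟨s(⟨v, hv⟩, ⟨h.neighbour t u, h.isVertex_neighbour t u⟩), by
    rw [SimpleGraph.mem_edgeSet, edgeGraph_adj]
    exact ⟨fun e => h.neighbour_ne t u (congrArg Subtype.val e), h.isDiagonalStep_neighbour t u⟩⟩
  plaq_injective := h.plaquette_injective
  mem_vertices := h.mem_plaquetteVertices hv
  mem_edge := by
    rintro ⟨e, he⟩
    constructor
    · intro hve
      obtain ⟨w, rfl⟩ := Sym2.mem_iff_exists.1 hve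
      rw [SimpleGraph.mem_edgeSet, edgeGraph_adj] at he
      obtain ⟨t, u, hw⟩ := h.exists_neighbour w.2 he.2
      refine ⟨t, u, Subtype.ext ?_⟩
      change s(_, w) = s(_, _)
      rw [show w = ⟨h.neighbour t u, h.isVertex_neighbour t u⟩ from Subtype.ext hw]
    · rintro ⟨t, u, hw⟩
      rw [hw]
      exact Sym2.mem_mk_left _ _
  edge_mem := by
    intro t u a q
    constructor
    · intro hq
      obtain ⟨r, rfl⟩ := (h.mem_plaquetteVertices hv a q).1 (hq _ (Sym2.mem_mk_left _ _))
      rw [(h.neighbour_mem_iff t u a r).1 (hq _ (Sym2.mem_mk_right _ _))]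
    · rintro rfl w hw
      rcases Sym2.mem_iff.1 hw with rfl | rfl
      · exact (h.mem_plaquetteVertices hv a _).2 ⟨_, rfl⟩
      · exact (h.neighbour_mem_iff t u a _).2 rfl

end IsFrame

/-- Every vertex has a star. -/
def vertexStar (v : Vertex L) : VertexStar v :=
  (isVertex_iff.1 v.2).choose_spec.choose_spec.choose_spec.choose_spec.star v.2

end Star

/-! ### Expansions of the partition functions -/

section Expansion

open scoped Classical

variable {L : Fin 3 → ℕ+}

/-- Any two of `t`, `u`, `t * u` determine the third: two plaquettes of different types at a vertex
share exactly one of its edges. -/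
lemma exists_unique_edgeIndex : ∀ a b : Axis, a ≠ b → ∀ r r' : ℤˣ,
    ∃ t u, (edgeIndex a t u = r ∧ edgeIndex b t u = r') ∧
      ∀ t' u', edgeIndex a t' u' = r → edgeIndex b t' u' = r' → t' = t ∧ u' = u := by
  decide

/-- Two plaquettes of different types share an even number of vertices. -/
lemma even_card_common_vertices {a b : Axis} (hab : a ≠ b) (p : PlaquetteOf L a)
    (q : PlaquetteOf L b) :
    Even (Finset.univ.filter fun v => v ∈ plaquetteVertices ⟨a, p⟩ ∧
      v ∈ plaquetteVertices ⟨b, q⟩).card := by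
  set VV : Finset (Vertex L) := Finset.univ.filter fun v => v ∈ plaquetteVertices ⟨a, p⟩ ∧
      v ∈ plaquetteVertices ⟨b, q⟩ with hVV
  set EE : Finset (Edge L) := Finset.univ.filter fun e => e ∈ plaquetteEdges ⟨a, p⟩ ∧
      e ∈ plaquetteEdges ⟨b, q⟩ with hEE
  -- Double counting: every common vertex lies on exactly one common edge, and both ends of a common
  -- edge are common vertices.
  have hc := Finset.sum_card_bipartiteAbove_eq_sum_card_bipartiteBelow (s := VV) (t := EE)
    (fun v e => v ∈ e.1)
  have h1 : ∀ v ∈ VV, (EE.bipartiteAbove (fun v e => v ∈ e.1) v).card = 1 := by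
    intro v hv
    simp only [hVV, Finset.mem_filter, Finset.mem_univ, true_and] at hv
    have S := vertexStar v
    obtain ⟨r, rfl⟩ := (S.mem_vertices a p).1 hv.1
    obtain ⟨r', rfl⟩ := (S.mem_vertices b q).1 hv.2
    obtain ⟨t, u, ⟨h1, h2⟩, h3⟩ := exists_unique_edgeIndex a b hab r r'
    rw [Finset.card_eq_one]
    refine ⟨S.edge t u, Finset.ext fun e => ?_⟩
    simp only [Finset.mem_bipartiteAbove, hEE, Finset.mem_filter, Finset.mem_univ, true_and,
      Finset.mem_singleton]
    constructor
    · rintro ⟨⟨ha, hb⟩, hve⟩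
      obtain ⟨t', u', rfl⟩ := (S.mem_edge e).1 hve
      rw [S.edge_mem] at ha hb
      obtain ⟨rfl, rfl⟩ := h3 t' u' (S.plaq_injective a ha).symm (S.plaq_injective b hb).symm
      rfl
    · rintro rfl
      refine ⟨⟨?_, ?_⟩, (S.mem_edge _).2 ⟨t, u, rfl⟩⟩ <;> rw [S.edge_mem]
      · rw [h1]
      · rw [h2]
  have h2 : ∀ e ∈ EE, (VV.bipartiteBelow (fun v e => v ∈ e.1) e).card = 2 := by
    rintro ⟨e, he⟩ hm
    simp only [hEE, Finset.mem_filter, Finset.mem_univ, true_and] at hm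
    induction e using Sym2.ind with
    | h v w =>
      have hvw : v ≠ w := (edgeGraph L).ne_of_adj he
      rw [← Finset.card_pair hvw]
      congr 1
      ext x
      simp only [Finset.mem_bipartiteBelow, hVV, Finset.mem_filter, Finset.mem_univ, true_and,
        Finset.mem_insert, Finset.mem_singleton]
      rw [Sym2.mem_iff]
      refine ⟨fun h => h.2, fun h => ⟨⟨hm.1 x (Sym2.mem_iff.2 h), hm.2 x (Sym2.mem_iff.2 h)⟩, h⟩⟩
  rw [Finset.sum_congr rfl h1, Finset.sum_congr rfl h2] at hc
  simp only [Finset.sum_const, smul_eq_mul, mul_one] at hc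
  rw [hc]
  exact even_two.mul_left _

/-- The incidence of plaquettes and edges. -/
def EdgeInc (L : Fin 3 → ℕ+) (p : Plaquette L) (e : Edge L) : Prop := e ∈ plaquetteEdges p

/-- The closed-surface expansion of the Ising gauge theory. -/
lemma gaugeZ_eq (β J : ℝ) (L : Fin 3 → ℕ+) :
    gaugeZ β J L = ((Real.cosh (β * J) ^ numPlaquettes L *
      evenSum (EdgeInc L) (Real.tanh (β * J)) : ℝ) : ℂ) := by
  rw [gaugeZ, gaugeHamiltonian, normalizedPartitionFunction_pauli_z, evenSum, Finset.sum_filter,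
    numPlaquettes, Complex.ofReal_mul, Complex.ofReal_pow, Complex.ofReal_sum]
  congr 1
  refine Finset.sum_congr rfl fun c _ => ?_
  rw [apply_ite Complex.ofReal, Complex.ofReal_pow, Complex.ofReal_zero]
  by_cases h : ∀ e, Even (incCount (EdgeInc L) c e)
  · rw [if_pos h]
    exact if_pos h
  · rw [if_neg h]
    exact if_neg h

/-- The plaquettes of type `a` in `c`. -/
def slice (c : Finset (Plaquette L)) (a : Axis) : Finset (PlaquetteOf L a) :=
  Finset.univ.filter fun q => (⟨a, q⟩ : Plaquette L) ∈ c

/-- The number of plaquettes of type `a` in `c` at the vertex `v`. -/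
def vertexCount (c : Finset (Plaquette L)) (v : Vertex L) (a : Axis) : ℕ :=
  incCount (fun (q : PlaquetteOf L a) v => v ∈ plaquetteVertices ⟨a, q⟩) (slice c a) v

/-- A set of plaquettes is given by its slices. -/
def sliceEquiv (L : Fin 3 → ℕ+) : Finset (Plaquette L) ≃ ∀ a, Finset (PlaquetteOf L a) where
  toFun := slice
  invFun f := Finset.univ.sigma f
  left_inv c := by
    ext ⟨a, q⟩
    simp [slice]
  right_inv f := by
    funext a
    ext q
    simp [slice]

lemma card_eq_sum_slice (c : Finset (Plaquette L)) : c.card = ∑ a, (slice c a).card := by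
  conv_lhs => rw [← (sliceEquiv L).left_inv c]
  exact Finset.card_sigma _ _

/-- The expansion of the model. -/
lemma modelZ_eq (β J : ℝ) (L : Fin 3 → ℕ+) :
    modelZ β J L = (Real.cosh (β * J) : ℂ) ^ numPlaquettes L *
      ∑ c : Finset (Plaquette L), (Real.tanh (β * J) : ℂ) ^ c.card *
        ∏ v, localTrace (vertexCount c v) := by
  rw [modelZ, modelHamiltonian, normalizedPartitionFunction_pauli _ _
    (fun a q => plaquetteVertices ⟨a, q⟩) fun a b hab p q => even_card_common_vertices hab p q,
    numPlaquettes, Fintype.card_sigma]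
  congr 1
  refine (Fintype.sum_equiv (sliceEquiv L) _ _ fun c => ?_).symm
  rw [card_eq_sum_slice]
  rfl

end Expansion

/-! ### Parities at a vertex -/

section Parity

open scoped Classical

variable {L : Fin 3 → ℕ+}

lemma sum_units {M : Type*} [AddCommMonoid M] (f : ℤˣ → M) : ∑ t, f t = f 1 + f (-1) := by
  rw [show (Finset.univ : Finset ℤˣ) = {1, -1} from rfl, Finset.sum_pair (by decide)]

namespace VertexStar

variable {v : Vertex L}

/-- Whether the `t`-th plaquette of type `a` at the vertex belongs to `c`. -/
def bit (S : VertexStar v) (c : Finset (Plaquette L)) (a : Axis) (t : ℤˣ) : Bool :=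
  decide ((⟨a, S.plaq a t⟩ : Plaquette L) ∈ c)

lemma vertexCount_eq (S : VertexStar v) (c : Finset (Plaquette L)) (a : Axis) :
    vertexCount c v a = (S.bit c a 1).toNat + (S.bit c a (-1)).toNat := by
  have h : (slice c a).filter (fun q => v ∈ plaquetteVertices ⟨a, q⟩) =
      ((Finset.univ : Finset ℤˣ).filter fun t => (⟨a, S.plaq a t⟩ : Plaquette L) ∈ c).image
        (S.plaq a) := by
    ext q
    simp only [slice, Finset.mem_filter, Finset.mem_univ, true_and, Finset.mem_image,
      S.mem_vertices]
    constructor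
    · rintro ⟨hq, t, rfl⟩
      exact ⟨t, hq, rfl⟩
    · rintro ⟨t, ht, rfl⟩
      exact ⟨ht, t, rfl⟩
  rw [vertexCount, incCount, h, Finset.card_image_of_injective _ (S.plaq_injective a),
    Finset.card_filter, sum_units]
  simp only [bit, Bool.toNat, Bool.cond_decide]

lemma incCount_edge (S : VertexStar v) (c : Finset (Plaquette L)) (t u : ℤˣ) :
    incCount (EdgeInc L) c (S.edge t u) =
      (S.bit c Axis.x t).toNat + (S.bit c Axis.y u).toNat + (S.bit c Axis.z (t * u)).toNat := by
  have h : c.filter (fun p => EdgeInc L p (S.edge t u)) =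
      ((Finset.univ : Finset Axis).filter fun a =>
        (⟨a, S.plaq a (edgeIndex a t u)⟩ : Plaquette L) ∈ c).image
        fun a => ⟨a, S.plaq a (edgeIndex a t u)⟩ := by
    ext ⟨a, q⟩
    simp only [EdgeInc, Finset.mem_filter, Finset.mem_univ, true_and, Finset.mem_image,
      S.edge_mem]
    constructor
    · rintro ⟨hq, rfl⟩
      exact ⟨a, hq, rfl⟩
    · rintro ⟨b, hb, e⟩
      obtain ⟨rfl, e⟩ := Sigma.mk.inj_iff.1 e
      obtain rfl := eq_of_heq e
      exact ⟨hb, rfl⟩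
  rw [incCount, h, Finset.card_image_of_injective _ fun a b e => (Sigma.mk.inj_iff.1 e).1,
    Finset.card_filter, sum_axis]
  simp only [bit, Bool.toNat, Bool.cond_decide, edgeIndex]
  congr

end VertexStar

/-- The product of the three Pauli matrices in the order x, y, z is `I` times the identity, while a
product of one or two distinct ones is traceless. -/
lemma localTrace_eq (f : Axis → ℕ) : localTrace f =
    if ∀ a, Even (f a) then 1 else if ∀ a, Odd (f a) then Complex.I else 0 := by
  have hall : ∀ p : Axis → Prop, (∀ a, p a) ↔ p Axis.x ∧ p Axis.y ∧ p Axis.z := fun p =>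
    ⟨fun h => ⟨h _, h _, h _⟩, fun h a => by cases a; exacts [h.1, h.2.1, h.2.2]⟩
  simp only [localTrace, pauli_pow, hall, ← Nat.not_even_iff_odd]
  by_cases h1 : Even (f Axis.x) <;> by_cases h2 : Even (f Axis.y) <;>
    by_cases h3 : Even (f Axis.z) <;> simp [h1, h2, h3, pauli, Matrix.trace]

lemma norm_localTrace_le (f : Axis → ℕ) : ‖localTrace f‖ ≤ 1 := by
  rw [localTrace_eq]
  split_ifs <;> simp

/-- If the Pauli operators of `c` have nonzero trace at `v`, the edges at `v` have equal parity. -/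
lemma even_iff_of_localTrace_ne_zero {c : Finset (Plaquette L)} {v : Vertex L}
    (h : localTrace (vertexCount c v) ≠ 0) {e e' : Edge L} (he : v ∈ e.1) (he' : v ∈ e'.1) :
    Even (incCount (EdgeInc L) c e) ↔ Even (incCount (EdgeInc L) c e') := by
  have S := vertexStar v
  obtain ⟨t, u, rfl⟩ := (S.mem_edge e).1 he
  obtain ⟨t', u', rfl⟩ := (S.mem_edge e').1 he'
  -- Changing `t` alters the parity at the edge by the sum of the X- and Z-counts at `v`, and
  -- changing `u` by the sum of the Y- and Z-counts; both sums are even. The final `decide` checks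
  -- this on the six membership bits.
  have hp : (∀ a, Even (vertexCount c v a)) ∨ ∀ a, Odd (vertexCount c v a) := by
    rw [localTrace_eq] at h
    by_contra! hc
    rw [if_neg (not_forall.2 (by simpa using hc.1)), if_neg (not_forall.2 (by simpa using hc.2))]
      at h
    exact h rfl
  simp only [S.incCount_edge]
  simp only [S.vertexCount_eq] at hp
  have hp' := hp.imp (fun h => (⟨h Axis.x, h Axis.y, h Axis.z⟩ : _ ∧ _ ∧ _))
    fun h => (⟨h Axis.x, h Axis.y, h Axis.z⟩ : _ ∧ _ ∧ _)
  clear hp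
  generalize S.bit c Axis.x = bx at *
  generalize S.bit c Axis.y = by' at *
  generalize S.bit c Axis.z = bz at *
  rcases Int.units_eq_one_or t with rfl | rfl <;> rcases Int.units_eq_one_or u with rfl | rfl <;>
  rcases Int.units_eq_one_or t' with rfl | rfl <;>
  rcases Int.units_eq_one_or u' with rfl | rfl <;>
  simp only [mul_one, mul_neg, neg_neg] <;>
  generalize bx 1 = x1 at * <;> generalize bx (-1) = x2 at * <;>
  generalize by' 1 = y1 at * <;> generalize by' (-1) = y2 at * <;>
  generalize bz 1 = z1 at * <;> generalize bz (-1) = z2 at * <;>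
  clear * - hp' <;> revert hp' <;> revert x1 x2 y1 y2 z1 z2 <;> decide

/-- The number of plaquettes of a closed surface at a vertex is `0`, `3` or `4`. -/
lemma vertexCount_of_even {c : Finset (Plaquette L)}
    (hc : ∀ e, Even (incCount (EdgeInc L) c e)) (v : Vertex L) :
    ((∀ a, Even (vertexCount c v a)) ∧ 4 ∣ ∑ a, vertexCount c v a) ∨
      ((∀ a, Odd (vertexCount c v a)) ∧ ∑ a, vertexCount c v a = 3) := by
  have S := vertexStar v
  -- The six plaquettes at `v` are the six pairs of its four edges, the types being the three
  -- perfect matchings of `K₄`. Evenness at the four edges makes `c` an even subgraph of `K₄`: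
  -- empty, a triangle with one pair of each type, or a 4-cycle made of two full matchings.
  have h1 := hc (S.edge 1 1)
  have h2 := hc (S.edge 1 (-1))
  have h3 := hc (S.edge (-1) 1)
  have h4 := hc (S.edge (-1) (-1))
  have hall : ∀ p : Axis → Prop, (∀ a, p a) ↔ p Axis.x ∧ p Axis.y ∧ p Axis.z := fun p =>
    ⟨fun h => ⟨h _, h _, h _⟩, fun h a => by cases a; exacts [h.1, h.2.1, h.2.2]⟩
  simp only [S.incCount_edge, mul_one, mul_neg, neg_neg] at h1 h2 h3 h4
  simp only [S.vertexCount_eq, sum_axis, hall]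
  generalize S.bit c Axis.x 1 = x1 at *
  generalize S.bit c Axis.x (-1) = x2 at *
  generalize S.bit c Axis.y 1 = y1 at *
  generalize S.bit c Axis.y (-1) = y2 at *
  generalize S.bit c Axis.z 1 = z1 at *
  generalize S.bit c Axis.z (-1) = z2 at *
  clear * - h1 h2 h3 h4
  revert x1 x2 y1 y2 z1 z2
  decide

/-- Here `(-I) ^ 3 = I` and `(-I) ^ 4 = 1`. In this form the product over the vertices can be
reorganized as a product over the plaquettes of `c`. -/
lemma localTrace_of_even {c : Finset (Plaquette L)}
    (hc : ∀ e, Even (incCount (EdgeInc L) c e)) (v : Vertex L) :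
    localTrace (vertexCount c v) = (-Complex.I) ^ ∑ a, vertexCount c v a := by
  rw [localTrace_eq]
  rcases vertexCount_of_even hc v with ⟨h, k, hk⟩ | ⟨h, hk⟩
  · rw [if_pos h, hk, pow_mul, neg_pow, Complex.I_pow_four]
    norm_num
  · rw [if_neg fun h' => Nat.not_even_iff_odd.2 (h Axis.x) (h' Axis.x), if_pos h, hk, neg_pow,
      Complex.I_pow_three]
    norm_num

/-- The number of vertices of a plaquette. -/
def plaquetteSize (p : Plaquette L) : ℕ :=
  (Finset.univ.filter fun v => v ∈ plaquetteVertices p).card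

lemma sum_vertexCount (c : Finset (Plaquette L)) (v : Vertex L) :
    ∑ a, vertexCount c v a = (c.filter fun p => v ∈ plaquetteVertices p).card := by
  rw [card_eq_sum_slice]
  refine Finset.sum_congr rfl fun a _ => ?_
  rw [vertexCount, incCount]
  congr 1
  ext q
  simp [slice]

lemma sum_sum_vertexCount (c : Finset (Plaquette L)) :
    ∑ v, ∑ a, vertexCount c v a = ∑ p ∈ c, plaquetteSize p := by
  simp only [sum_vertexCount]
  exact Finset.sum_card_bipartiteAbove_eq_sum_card_bipartiteBelow (s := Finset.univ) (t := c)
    fun v p => v ∈ plaquetteVertices p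

/-- Every edge is in at most three plaquettes. -/
lemma card_plaquettes_edge_le (e : Edge L) :
    (Finset.univ.filter fun p => EdgeInc L p e).card ≤ 3 := by
  obtain ⟨v, hv⟩ : ∃ v, v ∈ e.1 := ⟨e.1.out.1, Sym2.out_fst_mem _⟩
  have S := vertexStar v
  obtain ⟨t, u, rfl⟩ := (S.mem_edge e).1 hv
  have h := S.incCount_edge Finset.univ t u
  rw [incCount] at h
  rw [h]
  have hb : ∀ b : Bool, b.toNat ≤ 1 := Bool.toNat_le
  linarith [hb (S.bit Finset.univ Axis.x t), hb (S.bit Finset.univ Axis.y u),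
    hb (S.bit Finset.univ Axis.z (t * u))]

/-- All plaquettes of type `a`. -/
def allOf (L : Fin 3 → ℕ+) (a : Axis) : Finset (Plaquette L) :=
  Finset.univ.filter fun p => p.1 = a

/-- Adding all plaquettes of one type changes the parity at every edge. -/
lemma odd_symmDiff_allOf {c : Finset (Plaquette L)}
    (hc : ∀ e, Even (incCount (EdgeInc L) c e)) (a : Axis) (e : Edge L) :
    Odd (incCount (EdgeInc L) (symmDiff c (allOf L a)) e) := by
  obtain ⟨v, hv⟩ : ∃ v, v ∈ e.1 := ⟨e.1.out.1, Sym2.out_fst_mem _⟩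
  have S := vertexStar v
  obtain ⟨t, u, rfl⟩ := (S.mem_edge e).1 hv
  have h := hc (S.edge t u)
  have hbit : ∀ b r, S.bit (symmDiff c (allOf L a)) b r = xor (S.bit c b r) (decide (b = a)) := by
    intro b r
    simp only [VertexStar.bit, Finset.mem_symmDiff, allOf, Finset.mem_filter, Finset.mem_univ,
      true_and]
    by_cases h1 : (⟨b, S.plaq b r⟩ : Plaquette L) ∈ c <;> by_cases h2 : b = a <;> simp [h1, h2]
  rw [S.incCount_edge] at h ⊢
  simp only [hbit]
  generalize S.bit c Axis.x t = x at *
  generalize S.bit c Axis.y u = y at *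
  generalize S.bit c Axis.z (t * u) = z at *
  clear * - h
  cases a <;> cases x <;> cases y <;> cases z <;> revert h <;> simp <;> decide

lemma card_allOf (a : Axis) : (allOf L a).card = numOf L a := by
  rw [numOf, ← Finset.card_univ, ← Finset.card_map ⟨fun q => (⟨a, q⟩ : Plaquette L),
    fun _ _ h => eq_of_heq (Sigma.mk.inj_iff.1 h).2⟩]
  congr 1
  ext ⟨b, q⟩
  simp only [allOf, Finset.mem_filter, Finset.mem_univ, true_and, Finset.mem_map]
  constructor
  · rintro rfl
    exact ⟨q, rfl⟩
  · rintro ⟨q', h⟩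
    exact (Sigma.mk.inj_iff.1 h).1.symm

/-- The right-hand side is the total exponent of `α` in a cross term. -/
lemma card_symmDiff_allOf (c : Finset (Plaquette L)) (a : Axis) :
    ((symmDiff c (allOf L a)).card : ℤ) = c.card + (numOf L a - 2 * numIn a c) := by
  have h1 := Finset.card_sdiff_add_card_inter c (allOf L a)
  have h2 := Finset.card_sdiff_add_card_inter (allOf L a) c
  have h3 : (symmDiff c (allOf L a)).card = (c \ allOf L a).card + (allOf L a \ c).card := by
    rw [symmDiff, Finset.sup_eq_union]
    exact Finset.card_union_of_disjoint disjoint_sdiff_sdiff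
  have h4 : c ∩ allOf L a = c.filter fun p => p.1 = a := by
    ext p
    simp [allOf]
  have h5 : (c ∩ allOf L a).card = numIn a c := by
    rw [h4, numIn]
  rw [Finset.inter_comm, h5, card_allOf] at h2
  rw [h5] at h1
  omega

end Parity

/-! ### The sign of a closed surface -/

section Sign

open scoped Classical

variable {L : Fin 3 → ℕ+}

lemma IsFrame.unique {v : Torus L} {i j k i' j' k' : Fin 3} {s s' : ℤˣ} (h : IsFrame v i j k s)
    (h' : IsFrame v i' j' k' s') : i = i' ∧ j = j' ∧ k = k' := by
  have hs : ((s : ℤ) : ZMod 4) ≠ 0 ∧ ((s : ℤ) : ZMod 4) ≠ 2 := by clear * -; revert s; decide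
  have hi : i = i' := by
    rcases eq_or_of_distinct h.hij h.hik h.hjk i' with e | e | e
    · exact e.symm
    · exact absurd (h'.res_i.symm.trans (e ▸ h.res_j)) (by decide)
    · exact absurd ((e ▸ h.res_k : res v i' = _).symm.trans h'.res_i) hs.1
  have hj : j = j' := by
    rcases eq_or_of_distinct h.hij h.hik h.hjk j' with e | e | e
    · exact absurd (h'.res_j.symm.trans (e ▸ h.res_i)) (by decide)
    · exact e.symm
    · exact absurd ((e ▸ h.res_k : res v j' = _).symm.trans h'.res_j) hs.2
  subst hi hj
  refine ⟨rfl, rfl, ?_⟩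
  rcases eq_or_of_distinct h.hij h.hik h.hjk k' with e | e | e
  · exact absurd e h'.hik.symm
  · exact absurd e h'.hjk.symm
  · exact e.symm

lemma perm_ext : ∀ π π' : Equiv.Perm (Fin 3), π 0 = π' 0 → π 1 = π' 1 → π = π' := by decide

/-! ### The six vertices of a hexagon -/

section Hexagon

variable {q : Torus L}

/-- The signs of the coordinates of the centre of a hexagon. -/
def hexSign (hq : IsHexagonCentre q) (m : Fin 3) : ℤˣ := ((odd_residue_iff _).1 (hq m)).choose

lemma res_hexSign (hq : IsHexagonCentre q) (m : Fin 3) :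
    res q m = ((hexSign hq m : ℤ) : ZMod 4) := ((odd_residue_iff _).1 (hq m)).choose_spec

/-- The vertices of a hexagon. -/
def hexVertex (hq : IsHexagonCentre q) (π : Equiv.Perm (Fin 3)) : Torus L :=
  -- Subtracting its sign from an odd coordinate gives residue `0`, adding it gives `2`; thus `π`
  -- says which coordinate becomes `0`, which becomes `2` and which stays odd.
  q + unitStep L (π 0) (-hexSign hq (π 0)) + unitStep L (π 1) (hexSign hq (π 1))

lemma hexVertex_frame (hq : IsHexagonCentre q) (π : Equiv.Perm (Fin 3)) :
    IsFrame (hexVertex hq π) (π 0) (π 1) (π 2) (hexSign hq (π 2)) := by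
  have h01 : π 0 ≠ π 1 := by simp
  have h02 : π 0 ≠ π 2 := by simp
  have h12 : π 1 ≠ π 2 := by simp
  have h2 : ∀ s : ℤˣ, ((s : ℤ) : ZMod 4) + ((s : ℤ) : ZMod 4) = 2 := by decide
  refine ⟨h01, h02, h12, ?_, ?_, ?_⟩ <;>
    simp [hexVertex, res_add, res_unitStep, res_hexSign hq, h2]

lemma isVertex_hexVertex (hq : IsHexagonCentre q) (π : Equiv.Perm (Fin 3)) :
    IsVertex (hexVertex hq π) := isVertex_iff.2 ⟨_, _, _, _, hexVertex_frame hq π⟩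

lemma hexVertex_injective (hq : IsHexagonCentre q) : Function.Injective (hexVertex hq) := by
  intro π π' h
  have hf := hexVertex_frame hq π
  rw [h] at hf
  obtain ⟨h0, h1, -⟩ := hf.unique (hexVertex_frame hq π')
  exact perm_ext _ _ h0 h1

lemma isDiagonalStep_hexVertex (hq : IsHexagonCentre q) (π : Equiv.Perm (Fin 3)) :
    IsDiagonalStep (hexVertex hq π - q) :=
  isDiagonalStep_iff.2 ⟨π 0, π 1, _, _, by simp, by rw [hexVertex]; abel⟩

lemma exists_hexVertex (hq : IsHexagonCentre q) {v : Torus L} {i j k : Fin 3} {s : ℤˣ}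
    (h : IsFrame v i j k s) (hd : IsDiagonalStep (v - q)) :
    ∃ π : Equiv.Perm (Fin 3), π 0 = i ∧ π 1 = j ∧ v = hexVertex hq π := by
  obtain ⟨t, t', e⟩ := h.exists_of_hexagon hq hd
  obtain ⟨π, h0, h1, h2⟩ := exists_perm_of_distinct i j k h.hij h.hik h.hjk
  have hi : hexSign hq i = t := by
    have := (h.res_hexagon t t').1
    rw [← e, res_hexSign hq] at this
    clear * - this
    generalize hexSign hq i = x at *
    revert t x
    decide
  have hj : hexSign hq j = -t' := by
    have := (h.res_hexagon t t').2.1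
    rw [← e, res_hexSign hq] at this
    clear * - this
    generalize hexSign hq j = x at *
    revert t' x
    decide
  refine ⟨π, h0, h1, ?_⟩
  have e' : v = q - unitStep L i t - unitStep L j t' := by
    rw [e]
    abel
  rw [hexVertex, h0, h1, hi, hj, unitStep_neg, unitStep_neg]
  conv_lhs => rw [e']
  abel

lemma card_hexagon_vertices (hq : IsHexagonCentre q) :
    (Finset.univ.filter fun v : Vertex L => IsDiagonalStep (v.1 - q)).card = 6 := by
  have : (Finset.univ.filter fun v : Vertex L => IsDiagonalStep (v.1 - q)) =
      Finset.univ.image fun π => (⟨hexVertex hq π, isVertex_hexVertex hq π⟩ : Vertex L) := by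
    ext v
    simp only [Finset.mem_filter, Finset.mem_univ, true_and, Finset.mem_image]
    constructor
    · intro hd
      obtain ⟨i, j, k, s, h⟩ := isVertex_iff.1 v.2
      obtain ⟨π, -, -, e⟩ := exists_hexVertex hq h hd
      exact ⟨π, Subtype.ext e.symm⟩
    · rintro ⟨π, rfl⟩
      exact isDiagonalStep_hexVertex hq π
  rw [this, Finset.card_image_of_injective, Finset.card_univ, Fintype.card_perm, Fintype.card_fin]
  · rfl
  · intro π π' h
    exact hexVertex_injective hq (congrArg Subtype.val h)

/-- Every hexagon has exactly one vertex whose last two coordinates are `2` and `0` modulo `4`. -/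
lemma card_hexagon_marked (hq : IsHexagonCentre q) :
    (Finset.univ.filter fun v : Vertex L => (res v.1 2 = 0 ∧ res v.1 1 = 2) ∧
      IsDiagonalStep (v.1 - q)).card = 1 := by
  -- Prescribing which coordinate is `0` and which is `2` fixes the permutation, hence the vertex.
  obtain ⟨π, h0, h1, -⟩ := exists_perm_of_distinct 2 1 0 (by decide) (by decide) (by decide)
  rw [Finset.card_eq_one]
  refine ⟨⟨hexVertex hq π, isVertex_hexVertex hq π⟩, ?_⟩
  have hf := hexVertex_frame hq π
  ext v
  simp only [Finset.mem_filter, Finset.mem_univ, true_and, Finset.mem_singleton]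
  constructor
  · rintro ⟨⟨hv0, hv1⟩, hd⟩
    obtain ⟨i, j, k, s, h⟩ := isVertex_iff.1 v.2
    obtain ⟨π', h0', h1', e⟩ := exists_hexVertex hq h hd
    have hs : ((s : ℤ) : ZMod 4) ≠ 0 ∧ ((s : ℤ) : ZMod 4) ≠ 2 := by clear * -; revert s; decide
    have hi : 2 = i := by
      rcases eq_or_of_distinct h.hij h.hik h.hjk 2 with e | e | e
      · exact e
      · exact absurd (hv0.symm.trans (e ▸ h.res_j)) (by decide)
      · exact absurd ((e ▸ h.res_k : res v.1 2 = _).symm.trans hv0) hs.1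
    have hj : 1 = j := by
      rcases eq_or_of_distinct h.hij h.hik h.hjk 1 with e | e | e
      · exact absurd (hv1.symm.trans (e ▸ h.res_i)) (by decide)
      · exact e
      · exact absurd ((e ▸ h.res_k : res v.1 1 = _).symm.trans hv1) hs.2
    obtain rfl : π = π' := perm_ext _ _ (by rw [h0, h0', hi]) (by rw [h1, h1', hj])
    exact Subtype.ext e
  · rintro rfl
    exact ⟨⟨h0 ▸ hf.res_i, h1 ▸ hf.res_j⟩, isDiagonalStep_hexVertex hq π⟩

end Hexagon

/-! ### The four vertices of a square -/

section Square

variable {q : Torus L}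

/-- Of three residues in `{0, 2}`, not all equal, one differs from the other two; that axis `n` is
the normal of the square. -/
lemma exists_axes_of_square (hq : IsSquareCentre q) : ∃ n a b : Fin 3, n ≠ a ∧ n ≠ b ∧ a ≠ b ∧
    res q a = res q b ∧ res q n ≠ res q a := by
  obtain ⟨h, i, j, hij⟩ := hq
  have h02 : (0 : ZMod 4) ≠ 2 := by decide
  rcases h 0 with h0 | h0 <;> rcases h 1 with h1 | h1 <;> rcases h 2 with h2 | h2
  · exact absurd (by fin_cases i <;> fin_cases j <;> simp_all) hij
  · exact ⟨2, 0, 1, by decide, by decide, by decide, by rw [h0, h1], by rw [h2, h0]; exact h02.symm⟩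
  · exact ⟨1, 0, 2, by decide, by decide, by decide, by rw [h0, h2], by rw [h1, h0]; exact h02.symm⟩
  · exact ⟨0, 1, 2, by decide, by decide, by decide, by rw [h1, h2], by rw [h0, h1]; exact h02⟩
  · exact ⟨0, 1, 2, by decide, by decide, by decide, by rw [h1, h2], by rw [h0, h1]; exact h02.symm⟩
  · exact ⟨1, 0, 2, by decide, by decide, by decide, by rw [h0, h2], by rw [h1, h0]; exact h02⟩
  · exact ⟨2, 0, 1, by decide, by decide, by decide, by rw [h0, h1], by rw [h2, h0]; exact h02⟩
  · exact absurd (by fin_cases i <;> fin_cases j <;> simp_all) hij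

lemma isVertex_add_unitStep (hq : IsSquareCentre q) {n a b : Fin 3} (hna : n ≠ a) (hnb : n ≠ b)
    (hab : a ≠ b) (h : res q n ≠ res q b) (t : ℤˣ) : IsVertex (q + unitStep L a t) := by
  have hn : res (q + unitStep L a t) n = res q n := by simp [res_add, res_unitStep, hna]
  have hb : res (q + unitStep L a t) b = res q b := by simp [res_add, res_unitStep, hab.symm]
  have ha : ∃ s : ℤˣ, res (q + unitStep L a t) a = ((s : ℤ) : ZMod 4) := by
    rw [← odd_residue_iff, res_add, Pi.add_apply, res_unitStep, if_pos rfl]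
    rcases hq.1 a with h | h <;> rw [h] <;> clear * - <;> revert t <;> decide
  obtain ⟨s, hs⟩ := ha
  rw [isVertex_iff]
  rcases hq.1 n with h1 | h1 <;> rcases hq.1 b with h2 | h2
  · exact absurd (h1.trans h2.symm) h
  · exact ⟨n, b, a, s, hnb, hna, hab.symm, hn.trans h1, hb.trans h2, hs⟩
  · exact ⟨b, n, a, s, hnb.symm, hab.symm, hna, hb.trans h2, hn.trans h1, hs⟩
  · exact absurd (h1.trans h2.symm) h

lemma card_square_vertices (hq : IsSquareCentre q) :
    (Finset.univ.filter fun v : Vertex L => IsAxialStep (v.1 - q)).card = 4 := by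
  obtain ⟨n, a, b, hna, hnb, hab, h1, h2⟩ := exists_axes_of_square hq
  have ha : ∀ t, IsVertex (q + unitStep L a t) :=
    isVertex_add_unitStep hq hna hnb hab (h1 ▸ h2)
  have hb : ∀ t, IsVertex (q + unitStep L b t) :=
    isVertex_add_unitStep hq hnb hna hab.symm h2
  have hne : ∀ t u, unitStep L a t ≠ unitStep L b u := by
    intro t u e
    have := congrFun (congrArg res e) a
    rw [res_unitStep, res_unitStep, if_pos rfl, if_neg hab] at this
    clear * - this
    revert t
    decide
  have : (Finset.univ.filter fun v : Vertex L => IsAxialStep (v.1 - q)) =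
      Finset.univ.image (Sum.elim (fun t => (⟨_, ha t⟩ : Vertex L)) fun t => ⟨_, hb t⟩) := by
    ext v
    simp only [Finset.mem_filter, Finset.mem_univ, true_and, Finset.mem_image, Sum.exists,
      Sum.elim_inl, Sum.elim_inr]
    constructor
    · intro hd
      obtain ⟨i, j, k, s, h⟩ := isVertex_iff.1 v.2
      obtain ⟨t, e⟩ := h.exists_of_square hq hd
      have e' : v.1 = q + unitStep L k (-t) := by
        rw [unitStep_neg, e]
        abel
      -- A step along the normal leaves the two other residues equal, whereas a vertex needs one `0`
      -- and one `2` among them.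
      have hk : k ≠ n := by
        rintro rfl
        have hi : res q i = 0 := by
          rw [e]
          simp [res_add, res_unitStep, h.hik, h.res_i]
        have hj : res q j = 2 := by
          rw [e]
          simp [res_add, res_unitStep, h.hjk, h.res_j]
        have hr : ∀ m, m ≠ k → res q m = res q a := by
          intro m hm
          rcases eq_or_of_distinct hna hnb hab m with rfl | rfl | rfl
          · exact absurd rfl hm
          · rfl
          · exact h1.symm
        exact absurd (hi.symm.trans ((hr i h.hik).trans ((hr j h.hjk).symm.trans hj))) (by decide)
      rcases eq_or_of_distinct hna hnb hab k with rfl | rfl | rfl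
      · exact absurd rfl hk
      · exact Or.inl ⟨-t, Subtype.ext e'.symm⟩
      · exact Or.inr ⟨-t, Subtype.ext e'.symm⟩
    · rintro (⟨t, rfl⟩ | ⟨t, rfl⟩)
      · exact isAxialStep_iff.2 ⟨a, t, by simp⟩
      · exact isAxialStep_iff.2 ⟨b, t, by simp⟩
  rw [this, Finset.card_image_of_injective]
  · rfl
  · rintro (t | t) (u | u) e <;> have e' := add_left_cancel (congrArg Subtype.val e)
    · rw [IsFrame.unitStep_injective a e']
    · exact absurd e' (hne t u)
    · exact absurd e'.symm (hne u t)
    · rw [IsFrame.unitStep_injective b e']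

end Square

/-- Squares have four vertices and hexagons six, so only hexagons contribute a sign. -/
lemma neg_I_pow_plaquetteSize (p : Plaquette L) :
    (-Complex.I) ^ plaquetteSize p = if p.1 = Axis.y then 1 else -1 := by
  have h6 : (-Complex.I) ^ 6 = -1 := by
    rw [neg_pow, show 6 = 4 + 2 from rfl, pow_add Complex.I, Complex.I_pow_four, Complex.I_sq]
    norm_num
  obtain ⟨a, q, hq⟩ := p
  cases a
  · rw [show plaquetteSize ⟨Axis.x, q, hq⟩ = 6 from card_hexagon_vertices hq.1, h6]
    simp
  · rw [show plaquetteSize ⟨Axis.y, q, hq⟩ = 4 from card_square_vertices hq, neg_pow, Complex.I_pow_four]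
    norm_num
  · rw [show plaquetteSize ⟨Axis.z, q, hq⟩ = 6 from card_hexagon_vertices hq.1, h6]
    simp

/-- A closed surface has an even number of hexagons. -/
lemma even_card_hexagons {c : Finset (Plaquette L)}
    (hc : ∀ e, Even (incCount (EdgeInc L) c e)) :
    Even (c.filter fun p => p.1 ≠ Axis.y).card := by
  set M : Finset (Vertex L) := Finset.univ.filter fun v => res v.1 2 = 0 ∧ res v.1 1 = 2 with hM
  -- Double counting over the marked vertices: each hexagon has exactly one, and each sees an even
  -- number of hexagons of `c`, since the X- and Z-counts of a closed surface have equal parity.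
  have h := Finset.sum_card_bipartiteAbove_eq_sum_card_bipartiteBelow (s := M)
    (t := c.filter fun p => p.1 ≠ Axis.y) fun v p => v ∈ plaquetteVertices p
  have h1 : ∀ p ∈ c.filter fun p => p.1 ≠ Axis.y,
      (M.bipartiteBelow (fun v p => v ∈ plaquetteVertices p) p).card = 1 := by
    rintro ⟨a, q, hq⟩ hp
    have hp := (Finset.mem_filter.1 hp).2
    rw [Finset.bipartiteBelow, hM, Finset.filter_filter]
    cases a
    · exact card_hexagon_marked hq.1
    · exact absurd rfl hp
    · exact card_hexagon_marked hq.1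
  have h2 : ∀ v ∈ M, Even ((c.filter fun p => p.1 ≠ Axis.y).bipartiteAbove
      (fun v p => v ∈ plaquetteVertices p) v).card := by
    intro v _
    have e : ((c.filter fun p => p.1 ≠ Axis.y).bipartiteAbove
        (fun v p => v ∈ plaquetteVertices p) v).card =
        vertexCount c v Axis.x + vertexCount c v Axis.z := by
      rw [card_eq_sum_slice, sum_axis, show (slice _ Axis.y).card = 0 by
        simp [slice, Finset.bipartiteAbove], add_zero]
      simp only [vertexCount, incCount]
      congr 2 <;> ext q <;> simp [slice, Finset.bipartiteAbove]
    rw [e]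
    rcases vertexCount_of_even hc v with ⟨h, -⟩ | ⟨h, -⟩
    · exact (h _).add (h _)
    · exact (h _).add_odd (h _)
  rw [Finset.sum_congr rfl h1, Finset.sum_const, smul_eq_mul, mul_one] at h
  rw [← h]
  exact Finset.even_sum _ h2

/-- The product of the plaquette operators of a closed surface is the identity. -/
theorem prod_localTrace_of_even {c : Finset (Plaquette L)}
    (hc : ∀ e, Even (incCount (EdgeInc L) c e)) : ∏ v, localTrace (vertexCount c v) = 1 := by
  rw [Finset.prod_congr rfl fun v _ => localTrace_of_even hc v, Finset.prod_pow_eq_pow_sum,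
    sum_sum_vertexCount, ← Finset.prod_pow_eq_pow_sum]
  simp only [neg_I_pow_plaquetteSize]
  rw [Finset.prod_ite, Finset.prod_const_one, one_mul, Finset.prod_const]
  exact (even_card_hexagons hc).neg_one_pow

end Sign

/-! ### Connectedness and counting -/

section Connected

variable {L : Fin 3 → ℕ+}

/-- The vertex `u + 2 s e_j + t e_k` of the cell centred at `u`. -/
def cellVertex (u : Torus L) (j : Fin 3) (s : ℤˣ) (k : Fin 3) (t : ℤˣ) : Torus L :=
  u + unitStep L j s + unitStep L j s + unitStep L k t

lemma cellVertex_frame {u : Torus L} (hu : res u = 0) {i j k : Fin 3} (hij : i ≠ j) (hik : i ≠ k)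
    (hjk : j ≠ k) (s t : ℤˣ) : IsFrame (cellVertex u j s k t) i j k t := by
  have h2 : ((s : ℤ) : ZMod 4) + ((s : ℤ) : ZMod 4) = 2 := by clear * -; revert s; decide
  refine ⟨hij, hik, hjk, ?_, ?_, ?_⟩ <;>
    simp [cellVertex, res_add, res_unitStep, hu, hij, hik, hjk, hjk.symm, h2]

lemma exists_third : ∀ {j k : Fin 3}, j ≠ k → ∃ i : Fin 3, i ≠ j ∧ i ≠ k := by decide

lemma isVertex_cellVertex {u : Torus L} (hu : res u = 0) {j k : Fin 3} (hjk : j ≠ k) (s t : ℤˣ) :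
    IsVertex (cellVertex u j s k t) := by
  obtain ⟨i, hij, hik⟩ := exists_third hjk
  exact isVertex_iff.2 ⟨_, _, _, _, cellVertex_frame hu hij hik hjk s t⟩

lemma res_add_four {u : Torus L} (hu : res u = 0) (j : Fin 3) :
    res (u + unitStep L j 1 + unitStep L j 1 + unitStep L j 1 + unitStep L j 1) = 0 := by
  have h4 : (1 : ZMod 4) + 1 + 1 + 1 = 0 := by decide
  funext m
  rcases eq_or_ne m j with rfl | hm
  · simp [res_add, res_unitStep, hu, h4]
  · simp [res_add, res_unitStep, hu, hm]

variable {F : Torus L → Prop}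
  (hF : ∀ v w, IsVertex v → IsVertex w → IsDiagonalStep (w - v) → (F v ↔ F w))

include hF

/-- This is an edge of the cell joining two square faces; `iff_cellVertex_rotate` treats the edges
of one square face. -/
lemma iff_cellVertex_swap {u : Torus L} (hu : res u = 0) {j k : Fin 3} (hjk : j ≠ k) (s t : ℤˣ) :
    F (cellVertex u j s k t) ↔ F (cellVertex u k t j s) := by
  refine hF _ _ (isVertex_cellVertex hu hjk s t) (isVertex_cellVertex hu hjk.symm t s) ?_
  refine isDiagonalStep_iff.2 ⟨j, k, -s, t, hjk, ?_⟩
  rw [cellVertex, cellVertex, unitStep_neg]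
  abel

lemma iff_cellVertex_rotate {u : Torus L} (hu : res u = 0) {i j k : Fin 3} (hij : i ≠ j)
    (hik : i ≠ k) (hjk : j ≠ k) (s t r : ℤˣ) :
    F (cellVertex u j s k t) ↔ F (cellVertex u j s i r) := by
  refine hF _ _ (isVertex_cellVertex hu hjk s t) (isVertex_cellVertex hu hij.symm s r) ?_
  refine isDiagonalStep_iff.2 ⟨k, i, -t, r, hik.symm, ?_⟩
  rw [cellVertex, cellVertex, unitStep_neg]
  abel

lemma iff_cellVertex {u : Torus L} (hu : res u = 0) {j k : Fin 3} (hjk : j ≠ k) (s t : ℤˣ) :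
    F (cellVertex u j s k t) ↔ F (cellVertex u 0 1 1 1) := by
  -- The four vertices of a square face agree; two opposite ones are linked through a vertex on the
  -- third axis.
  have hface : ∀ {j k k' : Fin 3} (_ : j ≠ k) (_ : j ≠ k') (s t t' : ℤˣ),
      F (cellVertex u j s k t) ↔ F (cellVertex u j s k' t') := by
    intro j k k' hk hk' s t t'
    obtain ⟨i, hij, hik⟩ := exists_third hk
    rcases eq_or_of_distinct hij hik hk k' with rfl | rfl | rfl
    · exact iff_cellVertex_rotate hF hu hij hik hk s t t'
    · exact absurd rfl hk'
    · exact (iff_cellVertex_rotate hF hu hij hik hk s t 1).trans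
        (iff_cellVertex_rotate hF hu hij hik hk s t' 1).symm
  have hne : ∀ {j : Fin 3} (s : ℤˣ) (k : Fin 3) (t : ℤˣ) (_ : j ≠ k), j ≠ 0 →
      (F (cellVertex u j s k t) ↔ F (cellVertex u 0 1 1 1)) := by
    intro j s k t hjk h0
    exact (hface hjk h0 s t 1).trans ((iff_cellVertex_swap hF hu h0 s 1).trans
      (hface h0.symm (by decide) 1 s 1))
  rcases eq_or_ne j 0 with rfl | h0
  · exact (iff_cellVertex_swap hF hu hjk s t).trans (hne t 0 s hjk.symm hjk.symm)
  · exact hne s k t hjk h0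

/-- The cells centred at `u` and `u + 4 e_j` share a square, which lies on the positive side of the
first and the negative side of the second. -/
lemma iff_cell_translate {u : Torus L} (hu : res u = 0) (j : Fin 3) :
    F (cellVertex (u + unitStep L j 1 + unitStep L j 1 + unitStep L j 1 + unitStep L j 1) 0 1 1 1) ↔
      F (cellVertex u 0 1 1 1) := by
  obtain ⟨k, hjk⟩ : ∃ k, j ≠ k := ⟨j + 1, by revert j; decide⟩
  rw [← iff_cellVertex hF hu hjk 1 1, ← iff_cellVertex hF (res_add_four hu j) hjk (-1) 1]
  have : cellVertex (u + unitStep L j 1 + unitStep L j 1 + unitStep L j 1 + unitStep L j 1) j (-1)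
      k 1 = cellVertex u j 1 k 1 := by
    rw [cellVertex, cellVertex, unitStep_neg]
    abel
  rw [this]

lemma iff_cell_single {u : Torus L} (hu : res u = 0) (j : Fin 3) (n : ℕ) :
    res (u + Pi.single j ((4 * n : ℕ) : ZMod (4 * (L j : ℕ)))) = 0 ∧
    (F (cellVertex (u + Pi.single j ((4 * n : ℕ) : ZMod (4 * (L j : ℕ)))) 0 1 1 1) ↔
      F (cellVertex u 0 1 1 1)) := by
  induction n with
  | zero => simp [hu]
  | succ n ih =>
    have e : u + Pi.single j ((4 * (n + 1) : ℕ) : ZMod (4 * (L j : ℕ))) =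
        u + Pi.single j ((4 * n : ℕ) : ZMod (4 * (L j : ℕ))) + unitStep L j 1 + unitStep L j 1 +
          unitStep L j 1 + unitStep L j 1 := by
      simp only [unitStep, add_assoc, ← Pi.single_add]
      congr 2
      push_cast
      ring
    rw [e]
    exact ⟨res_add_four ih.1 j, (iff_cell_translate hF ih.1 j).trans ih.2⟩

omit hF in
lemma exists_four_mul {u : Torus L} (hu : res u = 0) (j : Fin 3) :
    ∃ n : ℕ, u j = ((4 * n : ℕ) : ZMod (4 * (L j : ℕ))) := by
  have h := congrFun hu j
  rw [res, ← ZMod.natCast_zmod_val (u j), map_natCast, Pi.zero_apply,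
    ZMod.natCast_eq_zero_iff] at h
  obtain ⟨n, hn⟩ := h
  exact ⟨n, by rw [← hn, ZMod.natCast_zmod_val]⟩

lemma iff_cell_zero {u : Torus L} (hu : res u = 0) :
    F (cellVertex u 0 1 1 1) ↔ F (cellVertex 0 0 1 1 1) := by
  choose n hn using exists_four_mul hu
  have h0 : res (0 : Torus L) = 0 := by
    funext i
    simp [res]
  have e : u = 0 + Pi.single 0 ((4 * n 0 : ℕ) : ZMod (4 * (L 0 : ℕ))) +
      Pi.single 1 ((4 * n 1 : ℕ) : ZMod (4 * (L 1 : ℕ))) +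
      Pi.single 2 ((4 * n 2 : ℕ) : ZMod (4 * (L 2 : ℕ))) := by
    funext i
    rw [hn i]
    fin_cases i <;> simp
  have s1 := iff_cell_single hF h0 0 (n 0)
  have s2 := iff_cell_single hF s1.1 1 (n 1)
  have s3 := iff_cell_single hF s2.1 2 (n 2)
  rw [e]
  exact s3.2.trans (s2.2.trans s1.2)

/-- A property of vertices that is invariant along edges is the same at all vertices. -/
lemma iff_of_invariant {v w : Torus L} (hv : IsVertex v) (hw : IsVertex w) : F v ↔ F w := by
  have key : ∀ {v}, IsVertex v → (F v ↔ F (cellVertex 0 0 1 1 1)) := by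
    intro v hv
    obtain ⟨i, j, k, s, h⟩ := isVertex_iff.1 hv
    -- A cell containing `v`: the coordinate `j` moves from residue `2` to `0` and the odd
    -- coordinate `k` is brought to `0`.
    set u := v + unitStep L j 1 + unitStep L j 1 + unitStep L k (-s) with hu
    have hr : res u = 0 := by
      have h4 : (2 : ZMod 4) + 1 + 1 = 0 := by decide
      funext m
      rcases eq_or_of_distinct h.hij h.hik h.hjk m with rfl | rfl | rfl
      · simp [hu, res_add, res_unitStep, h.hij, h.hik, h.res_i]
      · simp [hu, res_add, res_unitStep, h.hjk, h.res_j, h4]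
      · simp [hu, res_add, res_unitStep, h.hjk.symm, h.res_k]
    have e : v = cellVertex u j (-1) k s := by
      rw [cellVertex, hu, unitStep_neg, unitStep_neg]
      abel
    rw [e]
    exact (iff_cellVertex hF hr h.hjk _ _).trans (iff_cell_zero hF hr)
  exact (key hv).trans (key hw).symm

end Connected

/-! ### A nonzero trace forces the same parity at all edges -/

section Parity

open scoped Classical

variable {L : Fin 3 → ℕ+}

/-- A set of plaquettes whose operators have nonzero trace is even at all edges or odd at all
edges. -/
theorem even_or_odd_of_prod_ne_zero {c : Finset (Plaquette L)}
    (h : ∏ v, localTrace (vertexCount c v) ≠ 0) :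
    (∀ e, Even (incCount (EdgeInc L) c e)) ∨ ∀ e, Odd (incCount (EdgeInc L) c e) := by
  rw [Finset.prod_ne_zero_iff] at h
  -- `F q` says that some edge at `q` is even. By local equality of parities, any edge at `q`
  -- decides this, so `F` is constant along edges.
  set F : Torus L → Prop := fun q => ∃ e : Edge L, (∃ v ∈ e.1, v.1 = q) ∧
    Even (incCount (EdgeInc L) c e) with hFdef
  have hloc : ∀ (v : Vertex L) (e : Edge L), v ∈ e.1 →
      (F v.1 ↔ Even (incCount (EdgeInc L) c e)) := by
    intro v e he
    constructor
    · rintro ⟨e', ⟨v', hv', hvv⟩, he'⟩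
      obtain rfl := Subtype.ext hvv
      exact (even_iff_of_localTrace_ne_zero (h _ (Finset.mem_univ _)) hv' he).1 he'
    · exact fun hev => ⟨e, ⟨v, he, rfl⟩, hev⟩
  have hF : ∀ v w, IsVertex v → IsVertex w → IsDiagonalStep (w - v) → (F v ↔ F w) := by
    intro v w hv hw hd
    by_cases hvw : v = w
    · rw [hvw]
    have hadj : (edgeGraph L).Adj ⟨v, hv⟩ ⟨w, hw⟩ :=
      edgeGraph_adj.2 ⟨fun e => hvw (congrArg Subtype.val e), hd⟩
    set e : Edge L := ⟨s(⟨v, hv⟩, ⟨w, hw⟩), hadj⟩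
    exact (hloc ⟨v, hv⟩ e (Sym2.mem_mk_left _ _)).trans
      (hloc ⟨w, hw⟩ e (Sym2.mem_mk_right _ _)).symm
  by_contra! hc
  obtain ⟨⟨e, he⟩, e', he'⟩ := hc
  rw [Nat.not_odd_iff_even] at he'
  have m1 : e.1.out.1 ∈ e.1 := Sym2.out_fst_mem _
  have m2 : e'.1.out.1 ∈ e'.1 := Sym2.out_fst_mem _
  have := iff_of_invariant hF e.1.out.1.2 e'.1.out.1.2
  rw [hloc _ e m1, hloc _ e' m2] at this
  exact Nat.not_even_iff_odd.2 (by simpa using he) (this.2 he')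

end Parity

/-! ### Volume, plaquette counts and one marked edge per unit cell -/

section Counting

variable {L : Fin 3 → ℕ+}

/-- The indices of the unit cells. -/
abbrev UnitCell (L : Fin 3 → ℕ+) : Type := ∀ i, Fin (L i : ℕ)

lemma card_unitCell : Fintype.card (UnitCell L) = vol L := by
  simp [vol]

/-- The point of the unit cell `n` with all coordinates divisible by `4`. -/
def corner (n : UnitCell L) : Torus L := fun i => ((4 * (n i : ℕ) : ℕ) : ZMod (4 * (L i : ℕ)))

lemma corner_injective : Function.Injective (corner (L := L)) := by
  intro n m h
  funext i
  have hi := congrFun h i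
  simp only [corner] at hi
  rw [ZMod.natCast_eq_natCast_iff'] at hi
  have h1 := (n i).2
  have h2 := (m i).2
  rw [Nat.mod_eq_of_lt (by omega), Nat.mod_eq_of_lt (by omega)] at hi
  exact Fin.ext (by omega)

lemma res_corner (n : UnitCell L) : res (corner n) = 0 := by
  funext i
  simp only [res, corner, map_natCast, Pi.zero_apply]
  rw [ZMod.natCast_eq_zero_iff]
  exact Dvd.intro _ rfl

lemma vol_le_numOf (L : Fin 3 → ℕ+) (a : Axis) : vol L ≤ numOf L a := by
  have key : ∀ d : Torus L, (∀ n, IsCentre a (corner n + d)) → vol L ≤ numOf L a := by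
    intro d hd
    rw [← card_unitCell, numOf]
    refine Fintype.card_le_of_injective (fun n => ⟨corner n + d, hd n⟩) fun n m h => ?_
    exact corner_injective (add_right_cancel (congrArg Subtype.val h))
  have h0 : ∀ n : UnitCell L, ∀ s t, IsFrame (cellVertex (corner n) 1 s 2 t) 0 1 2 t := fun n s t =>
    cellVertex_frame (res_corner n) (by decide) (by decide) (by decide) s t
  have e : ∀ (n : UnitCell L) (d : Torus L), cellVertex (corner n) 1 1 2 1 + d =
      corner n + (unitStep L 1 1 + unitStep L 1 1 + unitStep L 2 1 + d) := by
    intro n d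
    rw [cellVertex]
    abel
  -- The displacement from the marked vertex of a cell to the plaquette centre is the same in all
  -- cells, so translation gives one plaquette of type `a` per cell.
  have hc : ∀ n, ∃ d : Torus L, (h0 n 1 1).centre a 1 = cellVertex (corner n) 1 1 2 1 + d ∧
      ∀ m, (h0 m 1 1).centre a 1 = cellVertex (corner m) 1 1 2 1 + d := by
    intro n
    cases a
    · exact ⟨unitStep L 0 1 + unitStep L 1 (-(1 * 1)), by rw [IsFrame.centre, add_assoc],
        fun m => by rw [IsFrame.centre, add_assoc]⟩
    · exact ⟨_, rfl, fun m => rfl⟩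
    · exact ⟨unitStep L 0 1 + unitStep L 1 (1 * 1), by rw [IsFrame.centre, add_assoc],
        fun m => by rw [IsFrame.centre, add_assoc]⟩
  obtain ⟨d, -, hd⟩ := hc fun i => ⟨0, (L i).pos⟩
  refine key (unitStep L 1 1 + unitStep L 1 1 + unitStep L 2 1 + d) fun n => ?_
  rw [← e, ← hd]
  exact (h0 n 1 1).isCentre a 1

lemma numPlaquettes_eq (L : Fin 3 → ℕ+) : numPlaquettes L = ∑ a, numOf L a :=
  Fintype.card_sigma

lemma vol_le_numPlaquettes (L : Fin 3 → ℕ+) : vol L ≤ numPlaquettes L := by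
  rw [numPlaquettes_eq]
  exact (vol_le_numOf L Axis.x).trans
    (Finset.single_le_sum (f := numOf L) (fun _ _ => Nat.zero_le _) (Finset.mem_univ _))

/-- A crude bound suffices: three types, each with at most as many centres as the `64 vol` points of
the torus. -/
lemma numPlaquettes_le (L : Fin 3 → ℕ+) : numPlaquettes L ≤ 192 * vol L := by
  have hT : Fintype.card (Torus L) = 64 * vol L := by
    rw [Fintype.card_pi]
    simp only [ZMod.card, Finset.prod_mul_distrib, vol]
    norm_num
  have h : ∀ a, numOf L a ≤ 64 * vol L := fun a =>
    hT ▸ Fintype.card_le_of_injective _ Subtype.val_injective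
  rw [numPlaquettes_eq, sum_axis]
  linarith [h Axis.x, h Axis.y, h Axis.z]

/-- One vertex in every unit cell. -/
def markedVertex (n : UnitCell L) : Vertex L :=
  ⟨cellVertex (corner n) 1 1 2 1, isVertex_cellVertex (res_corner n) (by decide) 1 1⟩

/-- One edge in every unit cell. -/
def markedEdge (n : UnitCell L) : Edge L := (vertexStar (markedVertex n)).edge 1 1

lemma markedVertex_mem (n : UnitCell L) : markedVertex n ∈ (markedEdge n).1 :=
  ((vertexStar _).mem_edge _).2 ⟨1, 1, rfl⟩

/-- Marked vertices all have the same residues, so their small displacements from the centre of `p`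
coincide by `IsSmall.ext`. -/
lemma eq_of_mem_markedEdge {p : Plaquette L} {n m : UnitCell L} (hn : EdgeInc L p (markedEdge n))
    (hm : EdgeInc L p (markedEdge m)) : n = m := by
  have h1 := IsFrame.isSmall_of_mem (hn _ (markedVertex_mem n))
  have h2 := IsFrame.isSmall_of_mem (hm _ (markedVertex_mem m))
  have h3 := h1.ext h2 (by simp [markedVertex, cellVertex, res_sub, res_add, res_corner])
  have h4 : corner n = corner m := by
    have := sub_left_injective h3
    simpa [markedVertex, cellVertex] using this
  exact corner_injective h4

lemma markedEdge_injective : Function.Injective (markedEdge (L := L)) := by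
  intro n m h
  have hp : EdgeInc L ⟨Axis.x, (vertexStar (markedVertex n)).plaq Axis.x 1⟩ (markedEdge n) :=
    ((vertexStar (markedVertex n)).edge_mem 1 1 Axis.x _).2 rfl
  exact eq_of_mem_markedEdge hp (h ▸ hp)

open scoped Classical in
/-- The odd sum is exponentially small in the volume, relative to the even sum. -/
theorem oddSum_edgeInc_le {α : ℝ} (h0 : 0 < α) (h1 : α < 1) (L : Fin 3 → ℕ+) :
    oddSum (EdgeInc L) α ≤ contraction α 3 ^ vol L * evenSum (EdgeInc L) α := by
  rw [← card_unitCell]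
  set own : Plaquette L → Option (UnitCell L) := fun p =>
    if h : ∃ n, EdgeInc L p (markedEdge n) then some h.choose else none with hown
  have key : ∀ p n, EdgeInc L p (markedEdge n) ↔ own p = some n := by
    intro p n
    constructor
    · intro h
      have hex : ∃ n, EdgeInc L p (markedEdge n) := ⟨n, h⟩
      rw [hown]
      simp only [dif_pos hex]
      rw [eq_of_mem_markedEdge hex.choose_spec h]
    · intro h
      rw [hown] at h
      by_cases hex : ∃ n, EdgeInc L p (markedEdge n)
      · simp only [dif_pos hex, Option.some.injEq] at h
        exact h ▸ hex.choose_spec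
      · simp only [dif_neg hex] at h
        exact absurd h (by simp)
  refine oddSum_le (EdgeInc L) h0 h1 markedEdge_injective key fun n => ?_
  have := card_plaquettes_edge_le (markedEdge n)
  simp only [key] at this
  convert this

end Counting

/-! ### Comparison of the partition functions -/

section Comparison

open scoped Classical

variable {L : Fin 3 → ℕ+} {α : ℝ}

lemma evenSum_mono {α' : ℝ} (h0 : 0 < α) (h : α ≤ α') :
    evenSum (EdgeInc L) α ≤ evenSum (EdgeInc L) α' :=
  Finset.sum_le_sum fun _ _ => pow_le_pow_left₀ h0.le h _

lemma norm_prod_localTrace_le (c : Finset (Plaquette L)) :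
    ‖∏ v, localTrace (vertexCount c v)‖ ≤ 1 := by
  rw [norm_prod]
  exact Finset.prod_le_one (fun _ _ => norm_nonneg _) fun v _ => norm_localTrace_le _

/-- In the expansion of the model the closed surfaces reproduce the gauge theory; the remaining
terms are bounded by the odd sum. -/
lemma norm_sum_sub_evenSum_le (h0 : 0 < α) :
    ‖∑ c : Finset (Plaquette L), (α : ℂ) ^ c.card * ∏ v, localTrace (vertexCount c v) -
      (evenSum (EdgeInc L) α : ℂ)‖ ≤ oddSum (EdgeInc L) α := by
  rw [evenSum, Finset.sum_filter, Complex.ofReal_sum, ← Finset.sum_sub_distrib, oddSum,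
    Finset.sum_filter]
  refine (norm_sum_le _ _).trans (Finset.sum_le_sum fun c _ => ?_)
  have hn : ‖(α : ℂ) ^ c.card‖ = α ^ c.card := by
    rw [norm_pow, Complex.norm_real, Real.norm_of_nonneg h0.le]
  -- Even sets cancel against the gauge theory, odd ones have trace of norm at most `1`, and all
  -- others have trace zero.
  by_cases he : ∀ e, Even (incCount (EdgeInc L) c e)
  · rw [if_pos he, prod_localTrace_of_even he, mul_one, Complex.ofReal_pow, sub_self, norm_zero]
    split_ifs
    · exact (pow_pos h0 _).le
    · exact le_rfl
  · rw [if_neg he, Complex.ofReal_zero, sub_zero]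
    by_cases ho : ∀ e, Odd (incCount (EdgeInc L) c e)
    · rw [if_pos ho, norm_mul, hn]
      exact mul_le_of_le_one_right (pow_pos h0 _).le (norm_prod_localTrace_le c)
    · rw [if_neg ho]
      by_contra! hc
      have : ∏ v, localTrace (vertexCount c v) ≠ 0 := fun h => by simp [h] at hc
      exact (even_or_odd_of_prod_ne_zero this).elim he ho

/-- For each type `a`, `c ↦ symmDiff c (allOf L a)` is injective and sends closed surfaces to odd
sets, with size equal to the exponent of the cross term. The factor `3` counts the types. -/
lemma crossTerms_le (h0 : 0 < α) : crossTerms α L ≤ 3 * oddSum (EdgeInc L) α := by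
  have h1 : ∀ a, ∑ c ∈ closedSurfaces L, α ^ (symmDiff c (allOf L a)).card ≤
      oddSum (EdgeInc L) α := by
    intro a
    rw [← Finset.sum_image (s := closedSurfaces L) (g := fun c => symmDiff c (allOf L a))
      (f := fun d => α ^ d.card) fun c _ d _ h => symmDiff_left_injective _ h]
    refine sum_pow_le_oddSum _ h0 _ fun d hd => ?_
    obtain ⟨c, hc, rfl⟩ := Finset.mem_image.1 hd
    rw [closedSurfaces, Finset.mem_filter] at hc
    exact odd_symmDiff_allOf hc.2 a
  have h2 : crossTerms α L = ∑ a, ∑ c ∈ (closedSurfaces L).filter fun c => c.Nonempty,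
      α ^ (symmDiff c (allOf L a)).card := by
    rw [Finset.sum_comm, crossTerms]
    refine Finset.sum_congr ?_ fun c _ => ?_
    · congr
    · rw [Finset.mul_sum]
      refine Finset.sum_congr rfl fun a _ => ?_
      rw [← zpow_natCast, ← zpow_add₀ h0.ne', ← zpow_natCast, card_symmDiff_allOf]
  rw [h2]
  calc _ ≤ ∑ _a : Axis, oddSum (EdgeInc L) α := by
        refine Finset.sum_le_sum fun a _ => le_trans ?_ (h1 a)
        exact Finset.sum_le_sum_of_subset_of_nonneg (Finset.filter_subset _ _)
          fun c _ _ => (pow_pos h0 _).le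
    _ = 3 * oddSum (EdgeInc L) α := by
        rw [sum_axis]
        ring

/-- With `y = α ^ vol ≤ 1`, `(1 + y) ^ 3 - 1 = 3y + 3y² + y³ ≤ 7y`. -/
lemma globalTerms_le (h0 : 0 < α) (h1 : α < 1) : globalTerms α L ≤ 7 * α ^ vol L := by
  set y := α ^ vol L with hy
  have hy0 : 0 ≤ y := (pow_pos h0 _).le
  have hy1 : y ≤ 1 := pow_le_one₀ h0.le h1.le
  have hx : ∀ a, α ^ numOf L a ≤ y := fun a => pow_le_pow_of_le_one h0.le h1.le (vol_le_numOf L a)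
  have : ∏ a : Axis, (1 + α ^ numOf L a) ≤ ∏ _a : Axis, (1 + y) :=
    Finset.prod_le_prod (fun a _ => by positivity) fun a _ => by linarith [hx a]
  rw [Finset.prod_const, Finset.card_univ, show Fintype.card Axis = 3 from rfl] at this
  rw [globalTerms]
  nlinarith [mul_nonneg hy0 (sub_nonneg.2 hy1), mul_nonneg (mul_nonneg hy0 hy0) (sub_nonneg.2 hy1)]

lemma tanh_strictMono : StrictMono Real.tanh := by
  intro x y h
  by_contra! hc
  have := Real.artanh_le_artanh (Real.neg_one_lt_tanh y) (Real.tanh_lt_one x) hc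
  rw [Real.artanh_tanh, Real.artanh_tanh] at this
  exact absurd h this.not_gt

lemma tanh_pos {x : ℝ} (hx : 0 < x) : 0 < Real.tanh x := by
  simpa using tanh_strictMono hx

/-- The rate of the exponential bounds, per unit cell. -/
def decayRate (α : ℝ) : ℝ := max (contraction α 3) α

lemma decayRate_pos (h0 : 0 < α) : 0 < decayRate α := lt_max_of_lt_right h0

lemma decayRate_lt_one (h0 : 0 < α) (h1 : α < 1) : decayRate α < 1 :=
  max_lt (contraction_lt_one h0 h1 3) h1

lemma oddSum_le_decayRate (h0 : 0 < α) (h1 : α < 1) (L : Fin 3 → ℕ+) :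
    oddSum (EdgeInc L) α ≤ decayRate α ^ vol L * evenSum (EdgeInc L) α :=
  (oddSum_edgeInc_le h0 h1 L).trans <| mul_le_mul_of_nonneg_right
    (pow_le_pow_left₀ (contraction_pos h0 h1 (by norm_num)).le (le_max_left _ _) _)
    (zero_le_one.trans (one_le_evenSum _ h0))

/-- The constant is `10 = 3 + 7`; `1 ≤ evenSum` absorbs the global terms. -/
lemma crossTerms_add_globalTerms_le (h0 : 0 < α) (h1 : α < 1) (L : Fin 3 → ℕ+) :
    crossTerms α L + globalTerms α L ≤ 10 * decayRate α ^ vol L * evenSum (EdgeInc L) α := by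
  have h2 := crossTerms_le (L := L) h0
  have h3 := oddSum_le_decayRate h0 h1 L
  have h4 := globalTerms_le (L := L) h0 h1
  have h5 : α ^ vol L ≤ decayRate α ^ vol L := pow_le_pow_left₀ h0.le (le_max_right _ _) _
  have h6 : decayRate α ^ vol L * 1 ≤ decayRate α ^ vol L * evenSum (EdgeInc L) α :=
    mul_le_mul_of_nonneg_left (one_le_evenSum _ h0) (pow_pos (decayRate_pos h0) _).le
  linarith

/-- The rate of the exponential bounds, per plaquette. -/
def plaquetteRate (α : ℝ) : ℝ := decayRate α ^ (1 / 192 : ℝ)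

lemma plaquetteRate_pos (h0 : 0 < α) : 0 < plaquetteRate α :=
  Real.rpow_pos_of_pos (decayRate_pos h0) _

lemma plaquetteRate_lt_one (h0 : 0 < α) (h1 : α < 1) : plaquetteRate α < 1 :=
  Real.rpow_lt_one (decayRate_pos h0).le (decayRate_lt_one h0 h1) (by norm_num)

lemma decayRate_pow_vol_le (h0 : 0 < α) (h1 : α < 1) (L : Fin 3 → ℕ+) :
    decayRate α ^ vol L ≤ plaquetteRate α ^ numPlaquettes L := by
  have h : plaquetteRate α ^ 192 = decayRate α := by
    rw [plaquetteRate, ← Real.rpow_natCast, ← Real.rpow_mul (decayRate_pos h0).le]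
    norm_num
  rw [← h, ← pow_mul]
  exact pow_le_pow_of_le_one (plaquetteRate_pos h0).le (plaquetteRate_lt_one h0 h1).le
    (numPlaquettes_le L)

lemma norm_gaugeZ (β J : ℝ) (hβJ : 0 < β * J) (L : Fin 3 → ℕ+) : ‖gaugeZ β J L‖ =
    Real.cosh (β * J) ^ numPlaquettes L * evenSum (EdgeInc L) (Real.tanh (β * J)) := by
  rw [gaugeZ_eq, Complex.norm_real, Real.norm_of_nonneg]
  exact mul_nonneg (pow_pos (Real.cosh_pos _) _).le
    (zero_le_one.trans (one_le_evenSum _ (tanh_pos hβJ)))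

lemma norm_ratio_sub_one_le (β J : ℝ) (hβJ : 0 < β * J) (L : Fin 3 → ℕ+) :
    ‖modelZ β J L / gaugeZ β J L - 1‖ ≤
      plaquetteRate (Real.tanh (β * J)) ^ numPlaquettes L := by
  set α := Real.tanh (β * J) with hα
  have h0 : 0 < α := tanh_pos hβJ
  have h1 : α < 1 := Real.tanh_lt_one _
  have hE : 0 < evenSum (EdgeInc L) α := zero_lt_one.trans_le (one_le_evenSum _ h0)
  have hcosh : (Real.cosh (β * J) : ℂ) ^ numPlaquettes L ≠ 0 :=
    pow_ne_zero _ (by exact_mod_cast (Real.cosh_pos _).ne')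
  have hEC : (evenSum (EdgeInc L) α : ℂ) ≠ 0 := by exact_mod_cast hE.ne'
  rw [modelZ_eq, gaugeZ_eq, ← hα, Complex.ofReal_mul, Complex.ofReal_pow,
    mul_div_mul_left _ _ hcosh, div_sub_one hEC, norm_div, Complex.norm_real,
    Real.norm_of_nonneg hE.le, div_le_iff₀ hE]
  exact (norm_sum_sub_evenSum_le h0).trans <| (oddSum_le_decayRate h0 h1 L).trans <|
    mul_le_mul_of_nonneg_right (decayRate_pow_vol_le h0 h1 L) hE.le

lemma cosh_mul_terms_le (β J : ℝ) (hβJ : 0 < β * J) (L : Fin 3 → ℕ+) :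
    Real.cosh (β * J) ^ numPlaquettes L *
      (crossTerms (Real.tanh (β * J)) L + globalTerms (Real.tanh (β * J)) L) ≤
    10 * plaquetteRate (Real.tanh (β * J)) ^ numPlaquettes L * ‖gaugeZ β J L‖ := by
  rw [norm_gaugeZ β J hβJ]
  set α := Real.tanh (β * J) with hα
  have h0 : 0 < α := tanh_pos hβJ
  have h1 : α < 1 := Real.tanh_lt_one _
  have hE : 0 < evenSum (EdgeInc L) α := zero_lt_one.trans_le (one_le_evenSum _ h0)
  calc _ ≤ Real.cosh (β * J) ^ numPlaquettes L *
        (10 * plaquetteRate α ^ numPlaquettes L * evenSum (EdgeInc L) α) := by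
        refine mul_le_mul_of_nonneg_left ?_ (pow_pos (Real.cosh_pos _) _).le
        refine (crossTerms_add_globalTerms_le h0 h1 L).trans ?_
        refine mul_le_mul_of_nonneg_right ?_ hE.le
        linarith [decayRate_pow_vol_le h0 h1 L]
    _ = _ := by ring

/-- Both the `cosh` prefactor and the positive closed-surface sum increase with the coupling. -/
lemma norm_gaugeZ_mono {β J J' : ℝ} (hβ : 0 < β) (hJ : 0 < J) (h : J ≤ J') (L : Fin 3 → ℕ+) :
    ‖gaugeZ β J L‖ ≤ ‖gaugeZ β J' L‖ := by
  have h1 : 0 < β * J := mul_pos hβ hJ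
  have h2 : β * J ≤ β * J' := mul_le_mul_of_nonneg_left h hβ.le
  have h3 : 0 < Real.tanh (β * J) := tanh_pos h1
  rw [norm_gaugeZ _ _ h1, norm_gaugeZ _ _ (h1.trans_le h2)]
  refine mul_le_mul (pow_le_pow_left₀ (Real.cosh_pos _).le ?_ _)
    (evenSum_mono h3 (tanh_strictMono.monotone h2))
    (zero_le_one.trans (one_le_evenSum _ h3)) (pow_pos (Real.cosh_pos _) _).le
  rw [Real.cosh_le_cosh, abs_of_pos h1, abs_of_pos (h1.trans_le h2)]
  exact h2

/-- A larger coupling whose hyperbolic tangent is the square root. -/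
lemma exists_renormalized_coupling {β J : ℝ} (hβ : 0 < β) (hJ : 0 < J) :
    ∃ J', J < J' ∧ Real.tanh (β * J') = Real.tanh (β * J) ^ (1 / 2 : ℝ) := by
  have h0 : 0 < Real.tanh (β * J) := tanh_pos (mul_pos hβ hJ)
  have h1 : Real.tanh (β * J) < 1 := Real.tanh_lt_one _
  have h2 : Real.tanh (β * J) ^ (1 / 2 : ℝ) < 1 := Real.rpow_lt_one h0.le h1 (by norm_num)
  have h3 : Real.tanh (β * J) < Real.tanh (β * J) ^ (1 / 2 : ℝ) := by
    conv_lhs => rw [← Real.rpow_one (Real.tanh (β * J))]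
    exact Real.rpow_lt_rpow_of_exponent_gt h0 h1 (by norm_num)
  have h4 : β * (Real.artanh (Real.tanh (β * J) ^ (1 / 2 : ℝ)) / β) =
      Real.artanh (Real.tanh (β * J) ^ (1 / 2 : ℝ)) := by
    field_simp
  have h5 : Real.tanh (β * (Real.artanh (Real.tanh (β * J) ^ (1 / 2 : ℝ)) / β)) =
      Real.tanh (β * J) ^ (1 / 2 : ℝ) := by
    rw [h4, Real.tanh_artanh ⟨by linarith, h2⟩]
  -- The witness is `J' = artanh (√α) / β`; `J < J'` because `α < √α` and `tanh` is strictly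
  -- increasing.
  refine ⟨_, ?_, h5⟩
  rw [← h5] at h3
  exact lt_of_mul_lt_mul_left (tanh_strictMono.lt_iff_lt.1 h3) hβ.le

end Comparison

end PlaquetteModel

end

theorem mainTheorem4 (β J : ℝ) (hβ : 0 < β) (hJ : 0 < J) :
    -- the ratio of the partition functions tends to `1` as the volume tends to infinity
    Tendsto (fun L : Fin 3 → ℕ+ => PlaquetteModel.modelZ β J L / PlaquetteModel.gaugeZ β J L)
      (comap PlaquetteModel.vol atTop) (𝓝 1) ∧
    -- the deviation from `1` is exponentially small in the number of plaquettes
    (∃ C lam : ℝ, 0 < lam ∧ lam < 1 ∧ ∀ L : Fin 3 → ℕ+,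
      ‖PlaquetteModel.modelZ β J L / PlaquetteModel.gaugeZ β J L - 1‖ ≤
        C * lam ^ PlaquetteModel.numPlaquettes L) ∧
    -- the cross terms and the global-product terms are exponentially small relative to `Z_IG(βJ)`
    (∃ C lam : ℝ, 0 < lam ∧ lam < 1 ∧ ∀ L : Fin 3 → ℕ+,
      Real.cosh (β * J) ^ PlaquetteModel.numPlaquettes L *
          (PlaquetteModel.crossTerms (Real.tanh (β * J)) L +
            PlaquetteModel.globalTerms (Real.tanh (β * J)) L) ≤
        C * lam ^ PlaquetteModel.numPlaquettes L * ‖PlaquetteModel.gaugeZ β J L‖) ∧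
    -- and they are compared with `Z_IG(βJ')` at a renormalized coupling `J' > J`
    (∃ ε J' C lam : ℝ, 0 < ε ∧ ε < 1 ∧ J < J' ∧
      Real.tanh (β * J') = Real.tanh (β * J) ^ ε ∧ 0 < lam ∧ lam < 1 ∧ ∀ L : Fin 3 → ℕ+,
      Real.cosh (β * J) ^ PlaquetteModel.numPlaquettes L *
          (PlaquetteModel.crossTerms (Real.tanh (β * J)) L +
            PlaquetteModel.globalTerms (Real.tanh (β * J)) L) ≤
        C * lam ^ PlaquetteModel.numPlaquettes L * ‖PlaquetteModel.gaugeZ β J' L‖) := by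
  have hβJ : 0 < β * J := mul_pos hβ hJ
  have h0 : 0 < Real.tanh (β * J) := PlaquetteModel.tanh_pos hβJ
  have h1 : Real.tanh (β * J) < 1 := Real.tanh_lt_one _
  have r0 := PlaquetteModel.plaquetteRate_pos h0
  have r1 := PlaquetteModel.plaquetteRate_lt_one h0 h1
  refine ⟨?_, ⟨1, _, r0, r1, fun L => ?_⟩, ⟨10, _, r0, r1, fun L => ?_⟩, ?_⟩
  · rw [tendsto_iff_norm_sub_tendsto_zero]
    have hn : Tendsto PlaquetteModel.numPlaquettes (comap PlaquetteModel.vol atTop) atTop :=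
      tendsto_atTop_mono PlaquetteModel.vol_le_numPlaquettes tendsto_comap
    exact squeeze_zero (fun _ => norm_nonneg _)
      (fun L => PlaquetteModel.norm_ratio_sub_one_le β J hβJ L)
      ((tendsto_pow_atTop_nhds_zero_of_lt_one r0.le r1).comp hn)
  · rw [one_mul]
    exact PlaquetteModel.norm_ratio_sub_one_le β J hβJ L
  · exact PlaquetteModel.cosh_mul_terms_le β J hβJ L
  · obtain ⟨J', hJ', ht⟩ := PlaquetteModel.exists_renormalized_coupling hβ hJ
    -- The bound at `J` already has a decaying factor and `‖gaugeZ‖` only grows from `J` to `J'`, so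
    -- the same `C` and `lam` serve; the value `ε = 1 / 2` is not critical.
    refine ⟨1 / 2, J', 10, _, by norm_num, by norm_num, hJ', ht, r0, r1, fun L => ?_⟩
    exact (PlaquetteModel.cosh_mul_terms_le β J hβJ L).trans <|
      mul_le_mul_of_nonneg_left (PlaquetteModel.norm_gaugeZ_mono hβ hJ hJ'.le L)
        (mul_nonneg (by norm_num) (pow_pos r0 _).le)
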